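/- Let $r\ge 1$. For $\mathbf b=(b_1,\dots,b_r)\in\mathbb Z_{\ge0}^r$ with $b_1\ge1$ let $\mathrm{Li}_{\mathbf u}(\mathbf z;\mathbf b)$ denote the analytic continuation to $(\mathbf u,\mathbf z)\in\mathbb C^r\times(\mathbb C\setminus\mathbb R_{\ge1})^r$ (it exists and is unique) of the series $$\sum_{l_1\ge b_1,\dots,l_r\ge b_r}\frac{z_1^{l_1}\cdots z_r^{l_r}}{l_1^{u_1}(l_1+l_2)^{u_2}\cdots(l_1+\cdots+l_r)^{u_r}}\qquad(\mathbf u\in\mathbb C^r,\ |z_j|<1).$$ Let $\sigma\in\mathfrak S_r$ and $\mathbf a,\mathbf b\in\mathbb Z_{\ge0}^r$ with $a_1,a_{\sigma^{-1}(1)},b_1,b_{\sigma^{-1}(1)}\ge1$ and $a_{\sigma(j)}+b_j\ge1$ for all $j$. Write $T_j=t_j+t_{j+1}+\cdots+t_r$ and $X_j=x_j+x_{j+1}+\cdots+x_r$. For $\mathbf u,\mathbf s\in\mathbb C^r$ with $\mathrm{Re}(u_j),\mathrm{Re}(s_j)>0$ for all $j$ put $$\eta(\mathbf u;\mathbf s;\sigma;\mathbf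 a;\mathbf b)=\prod_{j=1}^r\frac1{\Gamma(s_j)}\int_{(0,\infty)^r}\Bigl(\prod_{j=1}^r t_j^{s_j-1}e^{(1-a_j)T_j}\Bigr)\frac{\mathrm{Li}_{\mathbf u}(1-e^{T_{\sigma(1)}},\dots,1-e^{T_{\sigma(r)}};\mathbf b)}{\prod_{j=1}^r(1-e^{T_{\sigma(j)}})^{b_j}}\,dt_1\cdots dt_r,$$ the integral being absolutely convergent. For $\varepsilon>0$ let $\mathcal C_\varepsilon$ be the contour that goes from $+\infty$ to $\varepsilon$ along the real axis, once counterclockwise round the circle of radius $\varepsilon$ about $0$, and back from $\varepsilon$ to $+\infty$ along the real axis; powers $x^{w}$ on it are taken with $\arg x$ running continuously from $0$ (incoming ray) to $2\pi$ (outgoing ray). Then $\eta(\mathbf u;\mathbf s;\sigma;\mathbf a;\mathbf b)$ extends to an analytic function of $(\mathbf u,\mathbf s)$ on all of $\mathbb C^{2r}$. Moreover there is $\varepsilon_0>0$, depending only on $r$, such that for all such $\sigma,\mathbf a,\mathbf b$, all $0<\varepsilon<\varepsilon_0$ and all $\mathbf u,\mathbf s\in\mathbb C^r$ the integral $$H_\varepsilon(\mathbf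 u;\mathbf s)=\int_{(\mathcal C_\varepsilon)^{2r}}\prod_{j=1}^r t_j^{s_j-1}x_j^{u_j-1}\,\frac{e^{(1-a_{\sigma(j)})T_{\sigma(j)}}\,e^{(1-b_j)X_j}}{e^{T_{\sigma(j)}}+e^{X_j}-1}\,dt_j\,dx_j$$ converges absolutely, and the extended function satisfies $$\eta(\mathbf u;\mathbf s;\sigma;\mathbf a;\mathbf b)=\prod_{j=1}^r\frac{1}{(e^{2\pi iu_j}-1)(e^{2\pi is_j}-1)\Gamma(u_j)\Gamma(s_j)}\;H_\varepsilon(\mathbf u;\mathbf s)$$ whenever none of the $u_j,s_j$ is an integer. At integers the formula holds after removal of the singularities of the factors: for all $(\mathbf u,\mathbf s)\in\mathbb C^{2r}$, $$\prod_{j=1}^r g(u_j)\,g(s_j)\cdot\eta(\mathbf u;\mathbf s;\sigma;\mathbf a;\mathbf b)=H_\varepsilon(\mathbf u;\mathbf s),$$ where $g(w)=2\pi i\,e^{\pi iw}/\Gamma(1-w)$ is the entire function that extends $(e^{2\pi iw}-1)\Gamma(w)$. -/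

import Mathlib

open MeasureTheory

noncomputable section

namespace ArakawaKaneko

/-- The sum `t_j + t_{j+1} + ⋯ + t_r`. -/
def tailSum {r : ℕ} (t : Fin r → ℂ) (j : Fin r) : ℂ :=
  ∑ i ∈ Finset.Ici j, t i

/-- The series
`∑_{l_1 ≥ b_1, …, l_r ≥ b_r} z_1^{l_1} ⋯ z_r^{l_r} / (l_1^{u_1} ⋯ (l_1 + ⋯ + l_r)^{u_r})`,
summed over `m` with `l_j = b_j + m_j`. It is used for `|z_j| < 1` and `b_1 ≥ 1`, where it
converges absolutely. -/
def polylogSeries {r : ℕ} (b : Fin r → ℕ) (u z : Fin r → ℂ) : ℂ :=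
  ∑' m : Fin r → ℕ,
    ∏ j, z j ^ (b j + m j) / (((∑ i ∈ Finset.Iic j, (b i + m i) : ℕ) : ℂ) ^ u j)

/-- The region `ℂ^r × (ℂ ∖ ℝ_{≥ 1})^r` of pairs `(u, z)`. -/
def polylogDomain (r : ℕ) : Set ((Fin r → ℂ) × (Fin r → ℂ)) :=
  {p | ∀ j, p.2 j ∉ ((↑) : ℝ → ℂ) '' Set.Ici 1}

/-- `L` is the analytic continuation of the series `polylogSeries b` from
`ℂ^r × {|z_j| < 1}` to `ℂ^r × (ℂ ∖ ℝ_{≥ 1})^r`. As the latter region is open and star-shaped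
about the origin, there is at most one such function on it. -/
def IsPolylogContinuation {r : ℕ} (b : Fin r → ℕ)
    (L : (Fin r → ℂ) × (Fin r → ℂ) → ℂ) : Prop :=
  AnalyticOnNhd ℂ L (polylogDomain r) ∧
    ∀ u z : Fin r → ℂ, (∀ j, ‖z j‖ < 1) → L (u, z) = polylogSeries b u z

open Classical in
/-- The (analytically continued) multiple polylogarithm `Li_u(z; b)`. -/
def polylog {r : ℕ} (b : Fin r → ℕ) (u z : Fin r → ℂ) : ℂ :=
  if h : ∃ L : (Fin r → ℂ) × (Fin r → ℂ) → ℂ, IsPolylogContinuation b L then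
    h.choose (u, z)
  else 0

/-- The integrand in the definition of `η(u; s; σ; a; b)`, as a function of `t ∈ (0,∞)^r`. -/
def etaIntegrand {r : ℕ} (σ : Equiv.Perm (Fin r)) (a b : Fin r → ℕ) (u s : Fin r → ℂ)
    (t : Fin r → ℝ) : ℂ :=
  (∏ j, (t j : ℂ) ^ (s j - 1) *
      Complex.exp ((1 - (a j : ℂ)) * tailSum (fun i => (t i : ℂ)) j)) *
    (polylog b u (fun j => 1 - Complex.exp (tailSum (fun i => (t i : ℂ)) (σ j))) /
      ∏ j, (1 - Complex.exp (tailSum (fun i => (t i : ℂ)) (σ j))) ^ b j)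

/-- The function `η(u; s; σ; a; b)` as first defined, for `Re u_j > 0` and `Re s_j > 0`, by an
integral over `(0,∞)^r`. -/
def eta {r : ℕ} (σ : Equiv.Perm (Fin r)) (a b : Fin r → ℕ) (u s : Fin r → ℂ) : ℂ :=
  (∏ j, 1 / Complex.Gamma (s j)) *
    ∫ t in Set.univ.pi (fun _ : Fin r => Set.Ioi (0 : ℝ)), etaIntegrand σ a b u s t

/-- The contour which comes from `+∞` to `ε` along the real axis (`τ < 0`), goes once
counterclockwise round the circle of radius `ε` about the origin (`0 ≤ τ ≤ 2π`), and goes back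
to `+∞` along the real axis (`τ > 2π`). -/
def hankelPoint (ε τ : ℝ) : ℂ :=
  if τ < 0 then ((ε - τ : ℝ) : ℂ)
  else if τ ≤ 2 * Real.pi then (ε : ℂ) * Complex.exp (τ * Complex.I)
  else ((ε + (τ - 2 * Real.pi) : ℝ) : ℂ)

/-- The velocity of the contour. -/
def hankelVelocity (ε τ : ℝ) : ℂ :=
  if τ < 0 then -1
  else if τ ≤ 2 * Real.pi then (ε : ℂ) * Complex.exp (τ * Complex.I) * Complex.I
  else 1

/-- The logarithm along the contour, continued from its real value on the incoming ray, so that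
the argument runs from `0` on the incoming ray to `2π` on the outgoing one. -/
def hankelLog (ε τ : ℝ) : ℂ :=
  if τ < 0 then (Real.log (ε - τ) : ℂ)
  else if τ ≤ 2 * Real.pi then (Real.log ε : ℂ) + τ * Complex.I
  else (Real.log (ε + (τ - 2 * Real.pi)) : ℂ) + 2 * Real.pi * Complex.I

/-- The power `x^w` at the point `x` with parameter `τ` of the contour. -/
def hankelPow (ε : ℝ) (w : ℂ) (τ : ℝ) : ℂ :=
  Complex.exp (w * hankelLog ε τ)

/-- The integrand of the `2r`-fold contour integral, pulled back to the parameters: the first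
component of `p` parametrizes `(t_1, …, t_r)`, the second one `(x_1, …, x_r)`. -/
def contourIntegrand {r : ℕ} (ε : ℝ) (σ : Equiv.Perm (Fin r)) (a b : Fin r → ℕ)
    (u s : Fin r → ℂ) (p : (Fin r → ℝ) × (Fin r → ℝ)) : ℂ :=
  ∏ j, hankelPow ε (s j - 1) (p.1 j) * hankelPow ε (u j - 1) (p.2 j) *
    (Complex.exp ((1 - (a (σ j) : ℂ)) * tailSum (fun i => hankelPoint ε (p.1 i)) (σ j)) *
        Complex.exp ((1 - (b j : ℂ)) * tailSum (fun i => hankelPoint ε (p.2 i)) j) /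
      (Complex.exp (tailSum (fun i => hankelPoint ε (p.1 i)) (σ j)) +
        Complex.exp (tailSum (fun i => hankelPoint ε (p.2 i)) j) - 1)) *
    (hankelVelocity ε (p.1 j) * hankelVelocity ε (p.2 j))

/-- The `2r`-fold contour integral. -/
def contourIntegral {r : ℕ} (ε : ℝ) (σ : Equiv.Perm (Fin r)) (a b : Fin r → ℕ)
    (u s : Fin r → ℂ) : ℂ :=
  ∫ p : (Fin r → ℝ) × (Fin r → ℝ), contourIntegrand ε σ a b u s p

end ArakawaKaneko

end

noncomputable section

namespace ArakawaKaneko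

open Set Filter Topology Metric

/-! The function η is a 2r-fold normalised Mellin transform of an explicit kernel K(t,x)
(`etaKernel`), and normalised Mellin transforms of rapidly decaying holomorphic functions are
continued by Hankel contours.

To see the first point, expand 1/(1 - z_j e^{-X_j}) geometrically. Since x^{u-1}/Γ(u) integrates
e^{-ax} to a^{-u}, Li_u(z;b) is the Mellin transform in x of ∏ z_j^{b_j} e^{-b_j X_j}/(1 - z_j
e^{-X_j}). At z_j = 1 - e^{T_{σ(j)}} the denominator is e^{-X_j}(e^{T_{σ(j)}} + e^{X_j} - 1), so the
η-integrand is the x-integral of the Mellin integrand of K (`etaKernel_sum_elim`,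
`etaIntegrand_eq`), and Fubini gives η.

For the second point, let M_w f = Γ(w)^{-1} ∫ t^{w-1} f(t) dt for f holomorphic and exponentially
decaying on a half-strip around the positive axis. When Re w > 0, the Hankel integral of f collapses
to g(w) M_w f with g = `hankelFactor`. As g has no zero in Re w < 1, dividing the Hankel integral by
g continues M_w to that half-plane. Thus two representations cover the plane and agree on the
overlap. In several variables one takes tensor products of such functionals. Fubini allows one
coordinate to be exchanged at a time (`tensor_congr`), so every identity between transforms reduces
to one variable; analyticity follows from domination and Osgood's lemma (`analyticOnNhd_mellin`).

The same transform, applied in x with z as a parameter, is the analytic continuation of the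
polylogarithm (`exists_isPolylogContinuation`).

The estimate that makes this apply is `isDecaying_etaKernel`: K decays like e^{-(T_1 + X_1)/2} on a
half-strip whose width depends only on r. The factor with σ(j) = 1 supplies e^{-T_1}, the factor j =
1 supplies e^{(T_1 - X_1)/2}, and all others are bounded. -/

/-! ### Osgood's lemma -/

/-- Cauchy's integral formula on a polydisc, for separately holomorphic functions. -/
theorem torusIntegral_cauchy_kernel (n : ℕ) (c : Fin n → ℂ) {R : ℝ} (hR : 0 < R)
    (f : (Fin n → ℂ) → ℂ) (hf : ContinuousOn f (closedBall c R))
    (hd : ∀ x ∈ closedBall c R, ∀ i, DifferentiableAt ℂ (fun t => f (Function.update x i t)) (x i))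
    (z : Fin n → ℂ) (hz : z ∈ ball c R) :
    (∯ x in T(c, fun _ => R), (∏ i, (x i - z i)⁻¹) * f x) =
      (2 * Real.pi * Complex.I) ^ n * f z := by
  induction n with
  | zero =>
    rw [torusIntegral_dim0]
    simp [Subsingleton.elim c z]
  | succ n ih =>
    have hz' : ∀ i, z i ∈ ball (c i) R := by
      intro i
      rw [ball_pi _ hR] at hz
      exact hz i (mem_univ i)
    have hmem : ∀ θ : Fin (n + 1) → ℝ, torusMap c (fun _ => R) θ ∈ closedBall c R := by
      intro θ
      rw [closedBall_pi _ hR.le]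
      intro i _
      simp [torusMap, Complex.norm_exp, abs_of_pos hR]
    have hne : ∀ (θ : Fin (n + 1) → ℝ) (i), torusMap c (fun _ => R) θ i - z i ≠ 0 := by
      intro θ i h
      have h1 := hz' i
      rw [← sub_eq_zero.mp h] at h1
      simp [torusMap, Complex.norm_exp, abs_of_pos hR] at h1
    have hcont : Continuous (torusMap c (fun _ => R)) := by
      unfold torusMap; fun_prop
    have hint : TorusIntegrable (fun x => (∏ i, (x i - z i)⁻¹) * f x) c (fun _ => R) := by
      refine ContinuousOn.integrableOn_compact isCompact_Icc (Continuous.continuousOn ?_)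
      refine Continuous.mul ?_ (hf.comp_continuous hcont hmem)
      refine continuous_finsetProd _ fun i _ => ?_
      exact Continuous.inv₀ (((continuous_apply i).comp hcont).sub continuous_const)
        (fun θ => hne θ i)
    rw [torusIntegral_succ hint]
    have hcons : ∀ x ∈ closedBall (c 0) R, ∀ y ∈ closedBall (c ∘ Fin.succ) R,
        (Fin.cons x y : Fin (n + 1) → ℂ) ∈ closedBall c R := by
      intro x hx y hy
      rw [closedBall_pi _ hR.le] at hy ⊢
      intro i _
      refine Fin.cases ?_ (fun j => ?_) i
      · simpa using hx
      · simpa using hy j (mem_univ j)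
    have hzs : z ∘ Fin.succ ∈ ball (c ∘ Fin.succ) R := by
      rw [ball_pi _ hR]
      intro i _
      exact hz' i.succ
    -- With the first coordinate frozen on its circle, the induction hypothesis evaluates the other
    -- integrals; the one-variable Cauchy formula then handles the first.
    have inner : ∀ x ∈ sphere (c 0) R,
        (∯ y in T(c ∘ Fin.succ, (fun _ => R) ∘ Fin.succ),
          (∏ i, ((Fin.cons x y : Fin (n + 1) → ℂ) i - z i)⁻¹) * f (Fin.cons x y)) =
        (x - z 0)⁻¹ * ((2 * Real.pi * Complex.I) ^ n * f (Fin.cons x (z ∘ Fin.succ))) := by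
      intro x hx
      have hx' := sphere_subset_closedBall hx
      rw [← ih (c ∘ Fin.succ) (fun y => f (Fin.cons x y)) ?_ ?_ (z ∘ Fin.succ) hzs,
        ← torusIntegral_const_mul]
      · congr 1
        funext y
        simp [Fin.prod_univ_succ]
        ring
      · refine hf.comp (Continuous.continuousOn (by fun_prop)) fun y hy => hcons x hx' y hy
      · intro y hy i
        have := hd _ (hcons x hx' y hy) i.succ
        simpa [Fin.cons_update] using this
    rw [circleIntegral.integral_congr hR.le inner]
    have key := Complex.circleIntegral_sub_inv_smul_of_differentiable_on_off_countable
      (R := R) (c := c 0) (w := z 0) countable_empty (hz' 0)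
      (f := fun x => (2 * Real.pi * Complex.I) ^ n * f (Fin.cons x (z ∘ Fin.succ))) ?_ ?_
    · simp only [smul_eq_mul] at key
      rw [key]
      have : (Fin.cons (z 0) (z ∘ Fin.succ) : Fin (n + 1) → ℂ) = z := Fin.cons_self_tail z
      rw [this]; ring
    · refine continuousOn_const.mul (hf.comp (Continuous.continuousOn (by fun_prop))
        fun x hx => hcons x hx _ (ball_subset_closedBall hzs))
    · intro x hx
      have := hd _ (hcons x (ball_subset_closedBall hx.1) _ (ball_subset_closedBall hzs)) 0
      simp only [Fin.update_cons_zero, Fin.cons_zero] at this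
      exact this.const_mul _

/-- **Osgood's lemma** on `ℂⁿ`. -/
theorem analyticOnNhd_pi_of_separately (n : ℕ) {U : Set (Fin n → ℂ)} (hU : IsOpen U)
    (f : (Fin n → ℂ) → ℂ) (hf : ContinuousOn f U)
    (hd : ∀ x ∈ U, ∀ i, DifferentiableAt ℂ (fun t => f (Function.update x i t)) (x i)) :
    AnalyticOnNhd ℂ f U := by
  intro c hc
  obtain ⟨R, hR, hRU⟩ := nhds_basis_closedBall.mem_iff.mp (hU.mem_nhds hc)
  let K : Set (Fin n → ℝ) := Icc 0 fun _ => 2 * Real.pi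
  have : CompactSpace K := isCompact_iff_compactSpace.mp isCompact_Icc
  let μ : Measure K := (volume : Measure (Fin n → ℝ)).comap Subtype.val
  have : IsFiniteMeasure μ := by
    refine ⟨?_⟩
    have hK : MeasurableSet K := measurableSet_Icc
    rw [Measure.comap_apply _ Subtype.val_injective
      (fun s hs => (MeasurableEmbedding.subtype_coe hK).measurableSet_image.mpr hs) _
      MeasurableSet.univ]
    simpa using isCompact_Icc.measure_lt_top
  have hcont : Continuous (torusMap c (fun _ : Fin n => R)) := by
    unfold torusMap; fun_prop
  have hmem : ∀ θ : Fin n → ℝ, torusMap c (fun _ => R) θ ∈ closedBall c R := by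
    intro θ
    rw [closedBall_pi _ hR.le]
    intro i _
    simp [torusMap, Complex.norm_exp, abs_of_pos hR]
  let q : Fin n → C(K, ℂ) := fun i =>
    ⟨fun θ => torusMap c (fun _ => R) θ i, by fun_prop⟩
  let W : C(K, ℂ) :=
    ⟨fun θ => (∏ i : Fin n, (R : ℂ) * Complex.exp ((θ : Fin n → ℝ) i * Complex.I) * Complex.I) *
      f (torusMap c (fun _ => R) θ), by
      refine Continuous.mul (continuous_finsetProd _ fun i _ => ?_) ?_
      · have : Continuous fun θ : K => (θ : Fin n → ℝ) i :=
          (continuous_apply i).comp continuous_subtype_val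
        exact (continuous_const.mul (Complex.continuous_exp.comp
          ((Complex.continuous_ofReal.comp this).mul continuous_const))).mul continuous_const
      exact (hf.mono hRU).comp_continuous (hcont.comp continuous_subtype_val) fun θ => hmem θ⟩
  have hunit : ∀ z ∈ ball c R, ∀ i, IsUnit (q i - algebraMap ℂ C(K, ℂ) (z i)) := by
    intro z hz i
    rw [ContinuousMap.isUnit_iff_forall_ne_zero]
    intro θ h
    rw [ball_pi _ hR] at hz
    have h1 := hz i (mem_univ i)
    have h2 : torusMap c (fun _ => R) θ i - z i = 0 := h
    rw [← sub_eq_zero.mp h2] at h1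
    simp [torusMap, Complex.norm_exp, abs_of_pos hR] at h1
  -- The Cauchy integral is written as a continuous linear functional of a `C(K, ℂ)`-valued function
  -- of `z`. That function is analytic because inversion in a Banach algebra is, so no power series
  -- has to be expanded by hand.
  let Λ : C(K, ℂ) →L[ℂ] ℂ := LinearMap.mkContinuous
    { toFun := fun g => ∫ θ, g θ ∂μ
      map_add' := fun g h => integral_add (g.continuous.integrable_of_hasCompactSupport
        (HasCompactSupport.of_compactSpace _)) (h.continuous.integrable_of_hasCompactSupport
        (HasCompactSupport.of_compactSpace _))
      map_smul' := fun a g => integral_smul a _ } (μ.real univ) (fun g => by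
      have := norm_integral_le_of_norm_le_const (μ := μ) (f := fun θ => g θ) (C := ‖g‖)
        (ae_of_all _ fun θ => g.norm_coe_le_norm θ)
      simpa [mul_comm] using this)
  let G : (Fin n → ℂ) → C(K, ℂ) := fun z =>
    W * ∏ i, Ring.inverse (q i - algebraMap ℂ C(K, ℂ) (z i))
  have hG : AnalyticAt ℂ G c := by
    refine analyticAt_const.mul (Finset.analyticAt_fun_prod _ fun i _ => ?_)
    obtain ⟨u, hu⟩ := hunit c (mem_ball_self hR) i
    have h1 : AnalyticAt ℂ (fun z : Fin n → ℂ => q i - algebraMap ℂ C(K, ℂ) (z i)) c := by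
      refine analyticAt_const.sub ?_
      exact ((Algebra.linearMap ℂ C(K, ℂ)).toContinuousLinearMap.comp
        (ContinuousLinearMap.proj i)).analyticAt c
    have h2 := analyticAt_inverse (𝕜 := ℂ) u
    rw [hu] at h2
    exact AnalyticAt.comp (g := Ring.inverse)
      (f := fun z : Fin n → ℂ => q i - algebraMap ℂ C(K, ℂ) (z i)) h2 h1
  have hfin : AnalyticAt ℂ
      (fun z => ((2 * Real.pi * Complex.I) ^ n)⁻¹ * Λ (G z)) c :=
    analyticAt_const.mul ((Λ.analyticAt _).comp hG)
  refine hfin.congr ?_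
  filter_upwards [ball_mem_nhds c hR] with z hz
  have key := torusIntegral_cauchy_kernel n c hR f (hf.mono hRU)
    (fun x hx => hd x (hRU hx)) z hz
  have h2 : (2 * Real.pi * Complex.I) ^ n ≠ 0 := by
    simp [Real.pi_ne_zero]
  rw [inv_mul_eq_iff_eq_mul₀ h2, ← key, torusIntegral]
  change ∫ θ, G z θ ∂μ = _
  rw [← integral_subtype_comap measurableSet_Icc (fun θ : Fin n → ℝ =>
    (∏ i : Fin n, (R : ℂ) * Complex.exp (θ i * Complex.I) * Complex.I) •
      ((∏ i, (torusMap c (fun _ => R) θ i - z i)⁻¹) * f (torusMap c (fun _ => R) θ)))]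
  refine integral_congr_ae (ae_of_all _ fun θ => ?_)
  have hinv : ∀ i, (Ring.inverse (q i - algebraMap ℂ C(K, ℂ) (z i))) θ =
      (torusMap c (fun _ => R) θ i - z i)⁻¹ := by
    intro i
    have := congrArg (fun g : C(K, ℂ) => g θ) (Ring.mul_inverse_cancel _ (hunit z hz i))
    exact eq_inv_of_mul_eq_one_right this
  simp only [G, ContinuousMap.mul_apply, ContinuousMap.prod_apply, hinv, W,
    ContinuousMap.coe_mk, smul_eq_mul]
  ring

/-- **Osgood's lemma**: a continuous function on an open subset of a finite-dimensional space that
is holomorphic along all complex lines is analytic. -/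
theorem analyticOnNhd_of_continuousOn_of_lines {E : Type*} [NormedAddCommGroup E]
    [NormedSpace ℂ E] [FiniteDimensional ℂ E] {U : Set E} (hU : IsOpen U) (f : E → ℂ)
    (hf : ContinuousOn f U)
    (hd : ∀ x ∈ U, ∀ v : E, DifferentiableAt ℂ (fun t : ℂ => f (x + t • v)) 0) :
    AnalyticOnNhd ℂ f U := by
  let e : E ≃L[ℂ] (Fin (Module.finrank ℂ E) → ℂ) := ContinuousLinearEquiv.ofFinrankEq (by simp)
  have h : AnalyticOnNhd ℂ (f ∘ e.symm) (e.symm ⁻¹' U) := by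
    refine analyticOnNhd_pi_of_separately _ (hU.preimage e.symm.continuous) _
      (hf.comp e.symm.continuous.continuousOn fun x hx => hx) fun x hx i => ?_
    have h1 := hd (e.symm x) hx (e.symm (Pi.single i 1))
    have h2 : (fun t => (f ∘ e.symm) (Function.update x i t)) =
        (fun t : ℂ => f (e.symm x + t • e.symm (Pi.single i 1))) ∘ fun t => t - x i := by
      funext t
      simp only [Function.comp]
      rw [← map_smul, ← map_add]
      congr 2
      ext j
      by_cases hj : j = i
      · subst hj; simp
      · simp [hj]
    rw [h2]
    refine DifferentiableAt.comp _ ?_ (by fun_prop)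
    simpa using h1
  have h3 := h.comp (e.toContinuousLinearMap.analyticOnNhd U) (fun x hx => by simpa using hx)
  convert h3 using 1
  funext x
  simp

/-! ### Holomorphic dependence of dominated integrals -/

/-- One-variable differentiation under the integral sign for a dominated family of holomorphic
functions. -/
theorem differentiableAt_integral_of_dominated {Y : Type*} [MeasurableSpace Y] {μ : Measure Y}
    {G : ℂ → Y → ℂ} {t₀ : ℂ} {ρ : ℝ} (hρ : 0 < ρ)
    (hmeas : ∀ t ∈ ball t₀ ρ, AEStronglyMeasurable (G t) μ)
    (hd : ∀ y, DifferentiableOn ℂ (fun t => G t y) (ball t₀ ρ))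
    {B : Y → ℝ} (hB : Integrable B μ) (hle : ∀ t ∈ ball t₀ ρ, ∀ y, ‖G t y‖ ≤ B y) :
    DifferentiableAt ℂ (fun t => ∫ y, G t y ∂μ) t₀ := by
  have hsub : ∀ t ∈ ball t₀ (ρ / 2), ball t (ρ / 2) ⊆ ball t₀ ρ := by
    intro t ht s hs
    rw [mem_ball] at *
    linarith [dist_triangle s t t₀]
  -- Cauchy's estimate on circles of radius `ρ / 4` turns the bound on `G` into a bound on its
  -- derivative, so no separate domination of derivatives is assumed.
  have hbound : ∀ y, ∀ t ∈ ball t₀ (ρ / 2), ‖deriv (fun t => G t y) t‖ ≤ B y / (ρ / 4) := by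
    intro y t ht
    refine Complex.norm_deriv_le_of_forall_mem_sphere_norm_le (by positivity) ?_ ?_
    · refine (((hd y).mono (hsub t ht)).mono ?_).diffContOnCl
      rw [closure_ball _ (by positivity)]
      exact closedBall_subset_ball (by linarith)
    · intro z hz
      exact hle z (hsub t ht (sphere_subset_closedBall.trans
        (closedBall_subset_ball (by linarith)) hz)) y
  have hmem : ∀ n : ℕ, t₀ + ((ρ / 2 / (n + 1) : ℝ) : ℂ) ∈ ball t₀ ρ := by
    intro n
    have h1 : ρ / 2 / (n + 1) ≤ ρ / 2 := div_le_self (by positivity) (by linarith)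
    have h0 : 0 ≤ ρ / 2 / ((n : ℝ) + 1) := by positivity
    rw [mem_ball, dist_eq_norm, add_sub_cancel_left, Complex.norm_real, Real.norm_of_nonneg h0]
    linarith
  have hda : ∀ y, ∀ t ∈ ball t₀ (ρ / 2),
      HasDerivAt (fun t => G t y) (deriv (fun t => G t y) t) t := by
    intro y t ht
    exact ((hd y).differentiableAt (isOpen_ball.mem_nhds
      (ball_subset_ball (by linarith) ht))).hasDerivAt
  have h0 := mem_ball_self (x := t₀) (half_pos hρ)
  -- The derivative at `t₀` is a limit of difference quotients along a sequence; this is what makes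
  -- it measurable in `y`.
  have hlim : ∀ y, Tendsto (fun n : ℕ => (((ρ / 2 / (n + 1) : ℝ) : ℂ))⁻¹ *
      (G (t₀ + ((ρ / 2 / (n + 1) : ℝ) : ℂ)) y - G t₀ y)) atTop (𝓝 (deriv (fun t => G t y) t₀)) := by
    intro y
    have h1 := (hda y t₀ h0).tendsto_slope_zero
    simp only [smul_eq_mul] at h1
    refine h1.comp (tendsto_nhdsWithin_iff.mpr ⟨?_, Eventually.of_forall fun n => ?_⟩)
    · rw [← Complex.ofReal_zero]
      refine (Complex.continuous_ofReal.tendsto _).comp ?_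
      have := (tendsto_one_div_add_atTop_nhds_zero_nat (𝕜 := ℝ)).const_mul (ρ / 2)
      simpa [div_eq_mul_inv] using this
    · have : ρ / 2 / ((n : ℝ) + 1) ≠ 0 := by positivity
      simpa using Complex.ofReal_ne_zero.mpr this
  refine (hasDerivAt_integral_of_dominated_loc_of_deriv_le (s := ball t₀ (ρ / 2))
    (F := G) (F' := fun t y => deriv (fun t => G t y) t) (bound := fun y => B y / (ρ / 4))
    (ball_mem_nhds _ (by positivity)) ?_ ?_ ?_
    (ae_of_all _ hbound) (hB.div_const _) (ae_of_all _ hda)).2.differentiableAt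
  · filter_upwards [ball_mem_nhds t₀ hρ] with t ht using hmeas t ht
  · exact hB.mono' (hmeas _ (mem_ball_self hρ)) (ae_of_all _ (hle _ (mem_ball_self hρ)))
  · refine aestronglyMeasurable_of_tendsto_ae atTop (fun n => ?_) (ae_of_all _ hlim)
    exact ((hmeas _ (hmem n)).sub (hmeas _ (mem_ball_self hρ))).const_mul _

/-- The integral of a locally dominated family of holomorphic functions is analytic. -/
theorem analyticOnNhd_integral_of_dominated {E : Type*} [NormedAddCommGroup E]
    [NormedSpace ℂ E] [FiniteDimensional ℂ E] {U : Set E} (hU : IsOpen U)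
    {Y : Type*} [MeasurableSpace Y] {μ : Measure Y} {G : E → Y → ℂ}
    (hmeas : ∀ x ∈ U, AEStronglyMeasurable (G x) μ)
    (hd : ∀ y, DifferentiableOn ℂ (fun x => G x y) U)
    (hdom : ∀ x₀ ∈ U, ∃ B : Y → ℝ, Integrable B μ ∧ ∀ᶠ x in 𝓝 x₀, ∀ y, ‖G x y‖ ≤ B y) :
    AnalyticOnNhd ℂ (fun x => ∫ y, G x y ∂μ) U := by
  refine analyticOnNhd_of_continuousOn_of_lines hU _ (fun x₀ hx₀ => ?_) fun x₀ hx₀ v => ?_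
  · obtain ⟨B, hB, hle⟩ := hdom x₀ hx₀
    refine (continuousAt_of_dominated (bound := B) ?_ ?_ hB ?_).continuousWithinAt
    · filter_upwards [hU.mem_nhds hx₀] with x hx using hmeas x hx
    · filter_upwards [hle] with x hx using ae_of_all _ hx
    · exact ae_of_all _ fun y => ((hd y).differentiableAt (hU.mem_nhds hx₀)).continuousAt
  · obtain ⟨B, hB, hle⟩ := hdom x₀ hx₀
    have hc : ContinuousAt (fun t : ℂ => x₀ + t • v) 0 := by fun_prop
    have h1 : ∀ᶠ t : ℂ in 𝓝 0, x₀ + t • v ∈ U ∧ ∀ y, ‖G (x₀ + t • v) y‖ ≤ B y := by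
      have h2 : ∀ᶠ x in 𝓝 (x₀ + (0 : ℂ) • v), x ∈ U ∧ ∀ y, ‖G x y‖ ≤ B y := by
        rw [zero_smul, add_zero]
        exact (hU.eventually_mem hx₀).and hle
      exact hc.eventually h2
    obtain ⟨ρ, hρ, h⟩ := Metric.eventually_nhds_iff_ball.mp h1
    refine differentiableAt_integral_of_dominated (G := fun t y => G (x₀ + t • v) y) hρ
      (fun t ht => hmeas _ (h t ht).1) (fun y => ?_) hB (fun t ht => (h t ht).2)
    exact (hd y).comp (Differentiable.differentiableOn (by fun_prop)) fun t ht => (h t ht).1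

/-! ### Decaying functions, densities and their tensor products -/

/-- The half-strip `{Re x > -δ, |Im x| < δ}` around the positive real axis. -/
def strip (δ : ℝ) : Set ℂ := {x | -δ < x.re ∧ |x.im| < δ}

theorem isOpen_strip (δ : ℝ) : IsOpen (strip δ) :=
  (isOpen_lt continuous_const Complex.continuous_re).inter
    (isOpen_lt (continuous_abs.comp Complex.continuous_im) continuous_const)

theorem strip_mono {δ δ' : ℝ} (h : δ ≤ δ') : strip δ ⊆ strip δ' :=
  fun _ hx => ⟨by linarith [hx.1], hx.2.trans_le h⟩

/-- The `ι`-fold power of the half-strip. -/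
def polyStrip (ι : Type*) (δ : ℝ) : Set (ι → ℂ) := univ.pi fun _ => strip δ

theorem mem_polyStrip {ι : Type*} {δ : ℝ} {x : ι → ℂ} :
    x ∈ polyStrip ι δ ↔ ∀ i, x i ∈ strip δ := by
  simp [polyStrip]

/-- Holomorphic functions on the power of the half-strip that decay exponentially at rate `c`. -/
structure IsDecaying {ι : Type*} [Fintype ι] (δ c : ℝ) (K : (ι → ℂ) → ℂ) : Prop where
  diff : DifferentiableOn ℂ K (polyStrip ι δ)
  bound : ∃ C, ∀ x ∈ polyStrip ι δ, ‖K x‖ ≤ C * Real.exp (-c * ∑ i, (x i).re)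

/-- Holomorphic functions on the half-strip that decay exponentially at rate `c`. -/
structure IsDecayingOne (δ c : ℝ) (f : ℂ → ℂ) : Prop where
  diff : DifferentiableOn ℂ f (strip δ)
  bound : ∃ C, ∀ x ∈ strip δ, ‖f x‖ ≤ C * Real.exp (-c * x.re)

/-- A path `pt` in the complex plane with a complex density `wt`. -/
structure Density where
  pt : ℝ → ℂ
  wt : ℝ → ℂ

/-- The path stays in the half-strip, and the density integrates functions of decay rate `c`. -/
structure Density.Admissible (D : Density) (δ c : ℝ) : Prop where
  measurable_pt : Measurable D.pt
  measurable_wt : Measurable D.wt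
  mem : ∀ τ, D.pt τ ∈ strip δ
  integrable : Integrable fun τ => ‖D.wt τ‖ * Real.exp (-c * (D.pt τ).re)

/-- The functional `f ↦ ∫ f(pt τ) wt(τ) dτ`. -/
def Density.eval (D : Density) (f : ℂ → ℂ) : ℂ := ∫ τ, D.wt τ * f (D.pt τ)

/-- Two densities integrate all decaying holomorphic functions to the same value. -/
def Density.Agree (δ c : ℝ) (D D' : Density) : Prop :=
  ∀ f, IsDecayingOne δ c f → D.eval f = D'.eval f

/-- The integrand of `tensor`. -/
def tensorIntegrand {ι : Type*} [Fintype ι] (D : ι → Density) (K : (ι → ℂ) → ℂ) (τ : ι → ℝ) : ℂ :=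
  (∏ i, (D i).wt (τ i)) * K fun i => (D i).pt (τ i)

/-- The tensor product of functionals given by densities. -/
def tensor {ι : Type*} [Fintype ι] (D : ι → Density) (K : (ι → ℂ) → ℂ) : ℂ :=
  ∫ τ, tensorIntegrand D K τ

section

variable {ι : Type*} [Fintype ι] {δ c : ℝ}

/-- Factoring `g` through the subtype `s` avoids any hypothesis on `K` outside `s`, where the
kernels may have poles. -/
theorem measurable_comp_of_continuousOn {X Y : Type*} [TopologicalSpace X] [MeasurableSpace X]
    [BorelSpace X] [MeasurableSpace Y] {s : Set X} {K : X → ℂ} (hK : ContinuousOn K s)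
    {g : Y → X} (hg : Measurable g) (hgs : ∀ y, g y ∈ s) : Measurable fun y => K (g y) :=
  (continuousOn_iff_continuous_domRestrict.mp hK).measurable.comp (hg.subtype_mk (h := hgs))

theorem differentiableOn_prod {E : Type*} [NormedAddCommGroup E] [NormedSpace ℂ E] {U : Set E}
    {g : ι → E → ℂ} (hg : ∀ i, DifferentiableOn ℂ (g i) U) :
    DifferentiableOn ℂ (fun x => ∏ i, g i x) U := by
  classical
  exact fun x hx => (HasFDerivWithinAt.finsetProd fun i _ =>
    (hg i x hx).hasFDerivWithinAt).differentiableWithinAt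

theorem measurable_tensorIntegrand {D : ι → Density} {K : (ι → ℂ) → ℂ}
    (hD : ∀ i, (D i).Admissible δ c) (hK : ContinuousOn K (polyStrip ι δ)) :
    Measurable (tensorIntegrand D K) := by
  refine Measurable.mul (Finset.measurable_fun_prod _ fun i _ =>
    (hD i).measurable_wt.comp (measurable_pi_apply i)) ?_
  exact measurable_comp_of_continuousOn hK
    (measurable_pi_lambda _ fun i => (hD i).measurable_pt.comp (measurable_pi_apply i))
    fun τ => mem_polyStrip.mpr fun i => (hD i).mem _

/-- The exponential of a sum splits into a product over coordinates, so the majorant is a product of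
one-variable functions, integrable one variable at a time. -/
theorem norm_tensorIntegrand_le {D : ι → Density} {K : (ι → ℂ) → ℂ}
    (hD : ∀ i τ, (D i).pt τ ∈ strip δ) {C : ℝ}
    (hC : ∀ x ∈ polyStrip ι δ, ‖K x‖ ≤ C * Real.exp (-c * ∑ i, (x i).re)) (τ : ι → ℝ) :
    ‖tensorIntegrand D K τ‖ ≤
      C * ∏ i, (‖(D i).wt (τ i)‖ * Real.exp (-c * ((D i).pt (τ i)).re)) := by
  rw [tensorIntegrand, norm_mul, norm_prod, Finset.prod_mul_distrib, ← Real.exp_sum,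
    ← Finset.mul_sum]
  calc _ ≤ (∏ i, ‖(D i).wt (τ i)‖) * (C * Real.exp (-c * ∑ i, ((D i).pt (τ i)).re)) := by
        gcongr
        exact hC _ (mem_polyStrip.mpr fun i => hD i _)
    _ = _ := by ring

theorem integrable_tensorIntegrand {D : ι → Density} {K : (ι → ℂ) → ℂ}
    (hD : ∀ i, (D i).Admissible δ c) (hK : IsDecaying δ c K) :
    Integrable (tensorIntegrand D K) := by
  obtain ⟨C, hC⟩ := hK.bound
  refine Integrable.mono' ((Integrable.fintype_prod (μ := fun _ => volume)
    fun i => (hD i).integrable).const_mul C)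
    (measurable_tensorIntegrand hD hK.diff.continuousOn).aestronglyMeasurable
    (ae_of_all _ fun τ => norm_tensorIntegrand_le (fun i => (hD i).mem) hC τ)

theorem norm_tensor_le {D : ι → Density} {K : (ι → ℂ) → ℂ}
    (hD : ∀ i, (D i).Admissible δ c) {C : ℝ}
    (hC : ∀ x ∈ polyStrip ι δ, ‖K x‖ ≤ C * Real.exp (-c * ∑ i, (x i).re)) :
    ‖tensor D K‖ ≤
      C * ∏ i, ∫ τ, (‖(D i).wt τ‖ * Real.exp (-c * ((D i).pt τ).re)) := by
  rw [← integral_fintype_prod_volume_eq_prod (𝕜 := ℝ)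
    (fun i τ => ‖(D i).wt τ‖ * Real.exp (-c * ((D i).pt τ).re)), ← integral_const_mul]
  exact norm_integral_le_of_norm_le ((Integrable.fintype_prod (μ := fun _ => volume)
    fun i => (hD i).integrable).const_mul C)
    (ae_of_all _ fun τ => norm_tensorIntegrand_le (fun i => (hD i).mem) hC τ)

/-- A tensor integral depends analytically on parameters. -/
theorem analyticOnNhd_tensor {E : Type*} [NormedAddCommGroup E] [NormedSpace ℂ E]
    [FiniteDimensional ℂ E] {U : Set E} (hU : IsOpen U) (pt : ι → ℝ → ℂ) (wt : ι → E → ℝ → ℂ)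
    (K : E → (ι → ℂ) → ℂ)
    (hpt : ∀ i, Measurable (pt i)) (hmem : ∀ i τ, pt i τ ∈ strip δ)
    (hwt : ∀ i, ∀ x ∈ U, Measurable (wt i x))
    (hwd : ∀ i τ, DifferentiableOn ℂ (fun x => wt i x τ) U)
    (hdom : ∀ x₀ ∈ U, ∀ i, ∃ B : ℝ → ℝ, Integrable B ∧
      ∀ᶠ x in 𝓝 x₀, ∀ τ, ‖wt i x τ‖ * Real.exp (-c * (pt i τ).re) ≤ B τ)
    (hKd : ∀ y ∈ polyStrip ι δ, DifferentiableOn ℂ (fun x => K x y) U)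
    (hKc : ∀ x ∈ U, ContinuousOn (K x) (polyStrip ι δ))
    (hKb : ∀ x₀ ∈ U, ∃ C, ∀ᶠ x in 𝓝 x₀, ∀ y ∈ polyStrip ι δ,
      ‖K x y‖ ≤ C * Real.exp (-c * ∑ i, (y i).re)) :
    AnalyticOnNhd ℂ (fun x => tensor (fun i => ⟨pt i, wt i x⟩) (K x)) U := by
  refine analyticOnNhd_integral_of_dominated hU (fun x hx => ?_) (fun τ => ?_) fun x₀ hx₀ => ?_
  · refine Measurable.aestronglyMeasurable (Measurable.mul (Finset.measurable_fun_prod _ fun i _ =>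
      (hwt i x hx).comp (measurable_pi_apply i)) ?_)
    exact measurable_comp_of_continuousOn (hKc x hx)
      (measurable_pi_lambda _ fun i => (hpt i).comp (measurable_pi_apply i))
      fun τ => mem_polyStrip.mpr fun i => hmem i _
  · refine DifferentiableOn.mul ?_ ?_
    · exact differentiableOn_prod fun i => hwd i (τ i)
    exact hKd _ (mem_polyStrip.mpr fun i => hmem i _)
  · obtain ⟨C, hC⟩ := hKb x₀ hx₀
    choose B hB hle using hdom x₀ hx₀
    refine ⟨fun τ => |C| * ∏ i, B i (τ i),
      (Integrable.fintype_prod (μ := fun _ => volume) hB).const_mul _, ?_⟩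
    filter_upwards [hC, eventually_all.mpr hle] with x hx hx' τ
    refine (norm_tensorIntegrand_le (D := fun i => ⟨pt i, wt i x⟩) (C := |C|) (c := c) hmem
      (fun y hy => (hx y hy).trans ?_) τ).trans ?_
    · gcongr; exact le_abs_self C
    · gcongr with i
      exact hx' i (τ i)

end

/-- Fubini with the first coordinate integrated last. -/
theorem tensor_succ {n : ℕ} {δ c : ℝ} {D : Fin (n + 1) → Density} {K : (Fin (n + 1) → ℂ) → ℂ}
    (hD : ∀ i, (D i).Admissible δ c) (hK : IsDecaying δ c K) :
    tensor D K = (D 0).eval fun ζ => tensor (fun i => D i.succ) fun y => K (Fin.cons ζ y) := by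
  have hmp := (volume_preserving_piFinSuccAbove (fun _ : Fin (n + 1) => ℝ) 0).symm
  have hint := integrable_tensorIntegrand hD hK
  have h1 : Integrable (fun p : ℝ × (Fin n → ℝ) => tensorIntegrand D K (Fin.cons p.1 p.2))
      (volume.prod volume) := by
    have := (hmp.integrable_comp_emb (MeasurableEquiv.measurableEmbedding _)).mpr hint
    simpa [Function.comp_def, Fin.insertNthEquiv, Measure.volume_eq_prod] using this
  have h2 : tensor D K = ∫ p : ℝ × (Fin n → ℝ), tensorIntegrand D K (Fin.cons p.1 p.2)
      ∂(volume.prod volume) := by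
    rw [tensor, ← hmp.integral_comp']
    simp [Fin.insertNthEquiv, Measure.volume_eq_prod]
  rw [h2, integral_prod _ h1, Density.eval]
  congr 1
  funext τ
  rw [tensor, ← integral_const_mul]
  congr 1
  funext θ
  simp only [tensorIntegrand, Fin.prod_univ_succ, Fin.cons_zero, Fin.cons_succ, mul_assoc]
  congr 3
  funext i
  refine Fin.cases ?_ (fun j => ?_) i <;> simp

theorem IsDecaying.cons {n : ℕ} {δ c : ℝ} {K : (Fin (n + 1) → ℂ) → ℂ} (hK : IsDecaying δ c K)
    {ζ : ℂ} (hζ : ζ ∈ strip δ) : IsDecaying δ c fun y : Fin n → ℂ => K (Fin.cons ζ y) := by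
  have hm : ∀ y ∈ polyStrip (Fin n) δ, (Fin.cons ζ y : Fin (n + 1) → ℂ) ∈ polyStrip _ δ := by
    intro y hy
    rw [mem_polyStrip] at *
    exact Fin.cases hζ hy
  refine ⟨hK.diff.comp (Differentiable.differentiableOn ?_) hm, ?_⟩
  · rw [differentiable_pi]
    refine Fin.cases (by simp) fun j => ?_
    simp only [Fin.cons_succ]; fun_prop
  · obtain ⟨C, hC⟩ := hK.bound
    refine ⟨C * Real.exp (-c * ζ.re), fun y hy => (hC _ (hm y hy)).trans_eq ?_⟩
    rw [Fin.sum_univ_succ, mul_add, Real.exp_add]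
    simp only [Fin.cons_zero, Fin.cons_succ]
    ring

/-- Integrating out all but one variable stays within the one-variable test class. Hence agreement
of two densities on that class can be used inside a multiple integral. -/
theorem isDecayingOne_tensor_cons {n : ℕ} {δ c : ℝ} (hc : 0 ≤ c)
    {D : Fin n → Density} {K : (Fin (n + 1) → ℂ) → ℂ}
    (hD : ∀ i, (D i).Admissible δ c) (hK : IsDecaying δ c K) :
    IsDecayingOne δ c fun ζ => tensor D fun y => K (Fin.cons ζ y) := by
  obtain ⟨C, hC⟩ := hK.bound
  have hm : ∀ ζ ∈ strip δ, ∀ y ∈ polyStrip (Fin n) δ,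
      (Fin.cons ζ y : Fin (n + 1) → ℂ) ∈ polyStrip _ δ := by
    intro ζ hζ y hy
    rw [mem_polyStrip] at *
    exact Fin.cases hζ hy
  have hb : ∀ ζ ∈ strip δ, ∀ y ∈ polyStrip (Fin n) δ,
      ‖K (Fin.cons ζ y)‖ ≤ C * Real.exp (-c * ζ.re) * Real.exp (-c * ∑ i, (y i).re) := by
    intro ζ hζ y hy
    refine (hC _ (hm ζ hζ y hy)).trans_eq ?_
    rw [Fin.sum_univ_succ, mul_add, Real.exp_add]
    simp only [Fin.cons_zero, Fin.cons_succ]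
    ring
  constructor
  · refine AnalyticOnNhd.differentiableOn (analyticOnNhd_tensor (δ := δ) (c := c)
      (isOpen_strip δ) (fun i => (D i).pt) (fun i _ => (D i).wt) (fun ζ y => K (Fin.cons ζ y))
      (fun i => (hD i).measurable_pt) (fun i => (hD i).mem) (fun i _ _ => (hD i).measurable_wt)
      (fun i τ => differentiableOn_const _) (fun _ _ i => ⟨_, (hD i).integrable,
        Eventually.of_forall fun _ _ => le_rfl⟩) ?_ (fun ζ hζ => (hK.cons hζ).diff.continuousOn) ?_)
    · intro y hy
      refine hK.diff.comp (Differentiable.differentiableOn ?_) fun ζ hζ => hm ζ hζ y hy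
      rw [differentiable_pi]
      refine Fin.cases (by simp) fun j => ?_
      simp
    · intro ζ₀ hζ₀
      -- On the strip `Re ζ > -δ`, so `e^{-c Re ζ} ≤ e^{cδ}`: a majorant uniform in `ζ`.
      refine ⟨|C| * Real.exp (c * δ), ?_⟩
      filter_upwards [(isOpen_strip δ).mem_nhds hζ₀] with ζ hζ y hy
      have hexp : Real.exp (-c * ζ.re) ≤ Real.exp (c * δ) :=
        Real.exp_le_exp.mpr (by nlinarith [hζ.1])
      refine (hb ζ hζ y hy).trans (mul_le_mul_of_nonneg_right ?_ (Real.exp_pos _).le)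
      exact mul_le_mul (le_abs_self C) hexp (Real.exp_pos _).le (abs_nonneg C)
  · refine ⟨C * ∏ i, ∫ τ, (‖(D i).wt τ‖ * Real.exp (-c * ((D i).pt τ).re)), fun ζ hζ => ?_⟩
    refine (norm_tensor_le hD (hb ζ hζ)).trans_eq ?_
    ring

/-- The first density is exchanged with the primed densities already in the other slots; the
induction hypothesis, applied for each fixed value of the first variable, then exchanges the rest.
-/
theorem tensor_congr_fin {n : ℕ} {δ c : ℝ} (hc : 0 ≤ c) {D D' : Fin n → Density}
    {K : (Fin n → ℂ) → ℂ} (hD : ∀ i, (D i).Admissible δ c) (hD' : ∀ i, (D' i).Admissible δ c)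
    (h : ∀ i, Density.Agree δ c (D i) (D' i)) (hK : IsDecaying δ c K) :
    tensor D K = tensor D' K := by
  induction n with
  | zero => simp [tensor, tensorIntegrand, Subsingleton.elim (fun i => (D i).pt _) finZeroElim,
      Subsingleton.elim (fun i => (D' i).pt _) finZeroElim]
  | succ n ih =>
    rw [tensor_succ hD hK, tensor_succ hD' hK,
      ← h 0 _ (isDecayingOne_tensor_cons hc (fun i => hD' i.succ) hK)]
    simp only [Density.eval]
    congr 1
    funext τ
    rw [ih (fun i => hD i.succ) (fun i => hD' i.succ) (fun i => h i.succ)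
      (hK.cons ((hD 0).mem τ))]

theorem tensor_reindex {ι ι' : Type*} [Fintype ι] [Fintype ι'] (e : ι' ≃ ι) (D : ι → Density)
    (K : (ι → ℂ) → ℂ) :
    tensor (fun i => D (e i)) (fun y => K fun i => y (e.symm i)) = tensor D K := by
  have hmp := volume_measurePreserving_piCongrLeft (fun _ : ι => ℝ) e
  rw [tensor, tensor, ← hmp.integral_comp']
  congr 1
  funext τ
  have h : ∀ i, (MeasurableEquiv.piCongrLeft (fun _ : ι => ℝ) e) τ i = τ (e.symm i) := by
    intro i
    obtain ⟨j, rfl⟩ := e.surjective i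
    simp [MeasurableEquiv.coe_piCongrLeft, Equiv.piCongrLeft_apply_apply]
  simp only [tensorIntegrand, h]
  rw [← Equiv.prod_comp e]
  simp

/-- Tensor products of functionals that agree coordinatewise agree. -/
theorem tensor_congr {ι : Type*} [Fintype ι] {δ c : ℝ} (hc : 0 ≤ c) {D D' : ι → Density}
    {K : (ι → ℂ) → ℂ} (hD : ∀ i, (D i).Admissible δ c) (hD' : ∀ i, (D' i).Admissible δ c)
    (h : ∀ i, Density.Agree δ c (D i) (D' i)) (hK : IsDecaying δ c K) :
    tensor D K = tensor D' K := by
  let e := (Fintype.equivFin ι).symm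
  rw [← tensor_reindex e D, ← tensor_reindex e D']
  refine tensor_congr_fin hc (fun i => hD _) (fun i => hD' _) (fun i => h _) ⟨?_, ?_⟩
  · refine hK.diff.comp (Differentiable.differentiableOn (by fun_prop)) fun y hy => ?_
    rw [mem_polyStrip] at *
    exact fun i => hy _
  · obtain ⟨C, hC⟩ := hK.bound
    refine ⟨C, fun y hy => (hC _ ?_).trans_eq ?_⟩
    · rw [mem_polyStrip] at *
      exact fun i => hy _
    · rw [Equiv.sum_comp e.symm fun i => (y i).re]

/-! ### Hankel and real densities, and their domination -/

/-- The Hankel contour with the density `x^{w-1} dx`. -/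
def hankelDensity (ε : ℝ) (w : ℂ) : Density where
  pt := hankelPoint ε
  wt τ := hankelPow ε (w - 1) τ * hankelVelocity ε τ

/-- The positive real axis with the density `t^{w-1} dt / Γ(w)`. -/
def realDensity (w : ℂ) : Density where
  pt τ := ((max τ 0 : ℝ) : ℂ)
  wt τ := if 0 < τ then (τ : ℂ) ^ (w - 1) * (Complex.Gamma w)⁻¹ else 0

/-- A density multiplied by a scalar. -/
def Density.scale (a : ℂ) (D : Density) : Density where
  pt := D.pt
  wt τ := a * D.wt τ

/-- The entire function `2πi e^{πiw} / Γ(1 - w)`, which extends `(e^{2πiw} - 1) Γ(w)`. -/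
def hankelFactor (w : ℂ) : ℂ :=
  2 * Real.pi * Complex.I * Complex.exp (Real.pi * Complex.I * w) * (Complex.Gamma (1 - w))⁻¹

/-- A density for the functional `f ↦ 1/Γ(w) ∫₀^∞ t^{w-1} f(t) dt` and its continuation in `w`. -/
def mellinDensity (ε : ℝ) (w : ℂ) : Density :=
  if 0 < w.re then realDensity w else (hankelDensity ε w).scale (hankelFactor w)⁻¹

theorem measurable_hankelPoint (ε : ℝ) : Measurable (hankelPoint ε) := by
  unfold hankelPoint
  refine Measurable.ite measurableSet_Iio (by fun_prop)
    (Measurable.ite measurableSet_Iic (by fun_prop) (by fun_prop))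

theorem measurable_hankelVelocity (ε : ℝ) : Measurable (hankelVelocity ε) := by
  unfold hankelVelocity
  refine Measurable.ite measurableSet_Iio (by fun_prop)
    (Measurable.ite measurableSet_Iic (by fun_prop) (by fun_prop))

theorem measurable_hankelLog (ε : ℝ) : Measurable (hankelLog ε) := by
  unfold hankelLog
  refine Measurable.ite measurableSet_Iio (by fun_prop)
    (Measurable.ite measurableSet_Iic (by fun_prop) (by fun_prop))

theorem measurable_hankelDensity_wt (ε : ℝ) (w : ℂ) : Measurable (hankelDensity ε w).wt := by
  have h := measurable_hankelLog ε
  have h' := measurable_hankelVelocity ε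
  simp only [hankelDensity, hankelPow]
  fun_prop

theorem ofReal_mem_strip {δ t : ℝ} (hδ : 0 < δ) (ht : 0 ≤ t) : (t : ℂ) ∈ strip δ := by
  constructor
  · simp only [Complex.ofReal_re]; linarith
  · simpa using hδ

theorem mem_strip_of_norm_lt {δ : ℝ} {x : ℂ} (hx : ‖x‖ < δ) : x ∈ strip δ := by
  constructor
  · have := (abs_le.mp (Complex.abs_re_le_norm x)).1
    linarith
  · exact (Complex.abs_im_le_norm x).trans_lt hx

theorem hankelPoint_mem_strip {ε δ : ℝ} (hε : 0 < ε) (hδ : ε < δ) (τ : ℝ) :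
    hankelPoint ε τ ∈ strip δ := by
  unfold hankelPoint
  split_ifs with h1 h2
  · exact ofReal_mem_strip (hε.trans hδ) (by linarith)
  · refine mem_strip_of_norm_lt ?_
    rw [norm_mul, Complex.norm_exp_ofReal_mul_I, mul_one, Complex.norm_real,
      Real.norm_of_nonneg hε.le]
    exact hδ
  · exact ofReal_mem_strip (hε.trans hδ) (by linarith)

/-- Up to a constant the real part grows like the parameter on both rays; decay along the strip
therefore becomes decay in `|τ|`. -/
theorem le_hankelPoint_re {ε : ℝ} (hε : 0 < ε) (τ : ℝ) :
    |τ| - (2 * Real.pi + ε) ≤ (hankelPoint ε τ).re := by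
  have hpi := Real.pi_pos
  unfold hankelPoint
  split_ifs with h1 h2
  · rw [abs_of_neg h1, Complex.ofReal_re]; linarith
  · have h3 : ‖(ε : ℂ) * Complex.exp (τ * Complex.I)‖ = ε := by
      rw [norm_mul, Complex.norm_exp_ofReal_mul_I, mul_one, Complex.norm_real,
        Real.norm_of_nonneg hε.le]
    have h4 := (abs_le.mp (Complex.abs_re_le_norm ((ε : ℂ) * Complex.exp (τ * Complex.I)))).1
    rw [abs_of_nonneg (not_lt.mp h1)]
    linarith
  · rw [abs_of_nonneg (not_lt.mp h1), Complex.ofReal_re]; linarith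

theorem norm_hankelVelocity_le {ε : ℝ} (hε : 0 < ε) (τ : ℝ) : ‖hankelVelocity ε τ‖ ≤ 1 + ε := by
  unfold hankelVelocity
  split_ifs with h1 h2
  · simp [hε.le]
  · rw [norm_mul, norm_mul, Complex.norm_exp_ofReal_mul_I]
    simp [abs_of_pos hε]
  · simp [hε.le]

/-- Applying `log y ≤ y - 1` to `y = η(ε + s)` gives logarithmic growth at an arbitrarily small
linear rate `η`. Powers along the contour can then be absorbed by any exponential decay. -/
theorem abs_log_add_le {ε η s : ℝ} (hε : 0 < ε) (hη : 0 < η) (hs : 0 ≤ s) :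
    |Real.log (ε + s)| ≤ |Real.log ε| + |Real.log η| + η * ε + η * s := by
  have hpos : 0 < ε + s := by linarith
  have h1 : Real.log ε ≤ Real.log (ε + s) := Real.log_le_log hε (by linarith)
  have h2 := Real.log_le_sub_one_of_pos (mul_pos hη hpos)
  rw [Real.log_mul hη.ne' hpos.ne'] at h2
  have h3 := neg_abs_le (Real.log ε)
  have h4 := neg_abs_le (Real.log η)
  have h5 := abs_nonneg (Real.log ε)
  have h6 := abs_nonneg (Real.log η)
  rw [abs_le]
  constructor <;> nlinarith

theorem norm_hankelLog_le {ε η : ℝ} (hε : 0 < ε) (hη : 0 < η) (τ : ℝ) :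
    ‖hankelLog ε τ‖ ≤
      |Real.log ε| + |Real.log η| + η * ε + 2 * Real.pi + η * |τ| := by
  have hpi := Real.pi_pos
  have h7 := mul_pos hη hε
  have h6 := abs_nonneg (Real.log η)
  unfold hankelLog
  split_ifs with h1 h2
  · have := abs_log_add_le hε hη (s := -τ) (by linarith)
    rw [Complex.norm_real, Real.norm_eq_abs, abs_of_neg h1, sub_eq_add_neg]
    linarith
  · have h8 := mul_nonneg hη.le (abs_nonneg τ)
    refine (norm_add_le _ _).trans ?_
    rw [norm_mul, Complex.norm_I, Complex.norm_real, Complex.norm_real, Real.norm_eq_abs,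
      Real.norm_eq_abs]
    have : |τ| ≤ 2 * Real.pi := by rw [abs_of_nonneg (not_lt.mp h1)]; exact h2
    linarith
  · have := abs_log_add_le hε hη (s := τ - 2 * Real.pi) (by linarith)
    refine (norm_add_le _ _).trans ?_
    have h9 : ‖2 * (Real.pi : ℂ) * Complex.I‖ = 2 * Real.pi := by
      simp [abs_of_pos hpi]
    rw [h9, Complex.norm_real, Real.norm_eq_abs, abs_of_nonneg (not_lt.mp h1)]
    nlinarith [mul_pos hη hpi]

theorem integrable_exp_neg_mul_abs {b : ℝ} (hb : 0 < b) :
    Integrable fun x : ℝ => Real.exp (-b * |x|) := by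
  have h1 : IntegrableOn (fun x : ℝ => Real.exp (-b * |x|)) (Ioi 0) :=
    (exp_neg_integrableOn_Ioi 0 hb).congr_fun
      (fun x hx => by simp only [abs_of_pos (mem_Ioi.mp hx)]) measurableSet_Ioi
  have h2 : IntegrableOn (fun x : ℝ => Real.exp (-b * |x|)) (Iic 0) :=
    (integrableOn_exp_mul_Iic hb 0).congr_fun
      (fun x hx => by simp only [abs_of_nonpos (mem_Iic.mp hx), neg_mul_neg]) measurableSet_Iic
  rw [← integrableOn_univ, ← Iic_union_Ioi (a := (0 : ℝ))]
  exact h2.union h1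

/-- The Hankel densities are dominated, uniformly for bounded exponents. -/
theorem exists_bound_hankelDensity {ε c : ℝ} (hε : 0 < ε) (hc : 0 < c) (M : ℝ) :
    ∃ B : ℝ → ℝ, Integrable B ∧ ∀ w : ℂ, ‖w‖ ≤ M → ∀ τ,
      ‖(hankelDensity ε w).wt τ‖ * Real.exp (-c * (hankelPoint ε τ).re) ≤ B τ := by
  -- `N` bounds `‖w - 1‖`, and `η` is chosen with `N * η = c / 2`, so the power consumes exactly
  -- half of the decay rate.
  set N := |M| + 1 with hN
  have hNpos : 0 < N := by positivity
  set η := c / (2 * N) with hη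
  have hηpos : 0 < η := by positivity
  set A := |Real.log ε| + |Real.log η| + η * ε + 2 * Real.pi
  refine ⟨fun τ => (1 + ε) * Real.exp (N * A + c * (2 * Real.pi + ε)) *
    Real.exp (-(c / 2) * |τ|), (integrable_exp_neg_mul_abs (half_pos hc)).const_mul _, ?_⟩
  intro w hw τ
  have h1 : ‖hankelPow ε (w - 1) τ‖ ≤ Real.exp (N * (A + η * |τ|)) := by
    rw [hankelPow, Complex.norm_exp]
    refine Real.exp_le_exp.mpr ((Complex.re_le_norm _).trans ?_)
    rw [norm_mul]
    refine mul_le_mul ?_ (norm_hankelLog_le hε hηpos τ) (norm_nonneg _) hNpos.le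
    refine (norm_sub_le _ _).trans ?_
    rw [norm_one, hN]
    linarith [le_abs_self M]
  have h2 : Real.exp (-c * (hankelPoint ε τ).re) ≤
      Real.exp (-c * (|τ| - (2 * Real.pi + ε))) :=
    Real.exp_le_exp.mpr (by nlinarith [le_hankelPoint_re hε τ])
  calc ‖(hankelDensity ε w).wt τ‖ * Real.exp (-c * (hankelPoint ε τ).re)
      ≤ Real.exp (N * (A + η * |τ|)) * (1 + ε) * Real.exp (-c * (|τ| - (2 * Real.pi + ε))) := by
        simp only [hankelDensity, norm_mul]
        gcongr
        exact norm_hankelVelocity_le hε τ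
    _ = (1 + ε) * Real.exp (N * A + c * (2 * Real.pi + ε)) * Real.exp (-(c / 2) * |τ|) := by
        have : N * (A + η * |τ|) + -c * (|τ| - (2 * Real.pi + ε)) =
            (N * A + c * (2 * Real.pi + ε)) + -(c / 2) * |τ| := by
          have : N * η = c / 2 := by rw [hη]; field_simp
          linear_combination |τ| * this
        rw [mul_right_comm, ← Real.exp_add, this, Real.exp_add]
        ring

theorem admissible_hankelDensity {ε δ c : ℝ} (hε : 0 < ε) (hδ : ε < δ) (hc : 0 < c) (w : ℂ) :
    (hankelDensity ε w).Admissible δ c := by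
  obtain ⟨B, hB, hle⟩ := exists_bound_hankelDensity hε hc ‖w‖
  have hm := measurable_hankelDensity_wt ε w
  have hp := measurable_hankelPoint ε
  refine ⟨hp, hm, hankelPoint_mem_strip hε hδ, hB.mono' ?_ (ae_of_all _ fun τ => ?_)⟩
  · refine Measurable.aestronglyMeasurable ?_
    have hp' : Measurable fun τ => ((hankelDensity ε w).pt τ).re := Complex.measurable_re.comp hp
    fun_prop
  · rw [Real.norm_of_nonneg (by positivity)]
    exact hle w le_rfl τ

theorem Density.Admissible.scale {D : Density} {δ c : ℝ} (hD : D.Admissible δ c) (a : ℂ) :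
    (D.scale a).Admissible δ c := by
  refine ⟨hD.measurable_pt, hD.measurable_wt.const_mul a, hD.mem, ?_⟩
  simpa [Density.scale, norm_mul, mul_assoc] using hD.integrable.const_mul ‖a‖

theorem measurable_realDensity_wt (w : ℂ) : Measurable (realDensity w).wt := by
  unfold realDensity
  exact Measurable.ite measurableSet_Ioi (by fun_prop) (by fun_prop)

theorem measurable_realDensity_pt (w : ℂ) : Measurable (realDensity w).pt := by
  unfold realDensity
  fun_prop

/-- The densities `t^{w-1} / Γ(w)` are dominated, locally uniformly in `Re w > 0`. -/
theorem exists_bound_realDensity {c : ℝ} (hc : 0 < c) {w₀ : ℂ} (hw₀ : 0 < w₀.re) :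
    ∃ B : ℝ → ℝ, Integrable B ∧ ∀ᶠ w : ℂ in 𝓝 w₀, ∀ τ,
      ‖(realDensity w).wt τ‖ * Real.exp (-c * ((realDensity w).pt τ).re) ≤ B τ := by
  -- For exponents between `p` and `q`, `τ^{Re w - 1}` is at most `τ^{p-1} + τ^{q-1}`: the first
  -- term serves `τ ≤ 1`, the second `τ ≥ 1`.
  set p := w₀.re / 2 with hp
  set q := w₀.re + 1
  set M := ‖(Complex.Gamma w₀)⁻¹‖ + 1
  let B : ℝ → ℝ := (Ioi (0 : ℝ)).indicator fun τ =>
    M * (τ ^ (p - 1) * Real.exp (-c * τ ^ (1 : ℝ)) + τ ^ (q - 1) * Real.exp (-c * τ ^ (1 : ℝ)))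
  refine ⟨B, ?_, ?_⟩
  · refine IntegrableOn.integrable_indicator ?_ measurableSet_Ioi
    exact ((integrableOn_rpow_mul_exp_neg_mul_rpow (by linarith) one_pos hc).add
      (integrableOn_rpow_mul_exp_neg_mul_rpow (by linarith) one_pos hc)).const_mul M
  · have h1 : ∀ᶠ w : ℂ in 𝓝 w₀, p < w.re ∧ w.re < q :=
      (Complex.continuous_re.continuousAt.eventually_const_lt (by linarith)).and
        (Complex.continuous_re.continuousAt.eventually_lt_const (by linarith))
    have h2 : ∀ᶠ w : ℂ in 𝓝 w₀, ‖(Complex.Gamma w)⁻¹‖ < M :=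
      (Complex.differentiable_one_div_Gamma.continuous.norm.continuousAt).eventually_lt_const
        (by linarith)
    filter_upwards [h1, h2] with w ⟨hpw, hwq⟩ hG τ
    by_cases hτ : 0 < τ
    · simp only [realDensity, if_pos hτ, B, indicator_of_mem (mem_Ioi.mpr hτ), norm_mul,
        max_eq_left hτ.le, Complex.ofReal_re, Complex.norm_cpow_eq_rpow_re_of_pos hτ,
        Complex.sub_re, Complex.one_re, Real.rpow_one]
      have h3 : τ ^ (w.re - 1) ≤ τ ^ (p - 1) + τ ^ (q - 1) := by
        have hp' := Real.rpow_nonneg hτ.le (p - 1)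
        have hq' := Real.rpow_nonneg hτ.le (q - 1)
        rcases le_total τ 1 with h | h
        · have := Real.rpow_le_rpow_of_exponent_ge hτ h (show p - 1 ≤ w.re - 1 by linarith)
          linarith
        · have := Real.rpow_le_rpow_of_exponent_le h (show w.re - 1 ≤ q - 1 by linarith)
          linarith
      calc _ ≤ (τ ^ (p - 1) + τ ^ (q - 1)) * M * Real.exp (-c * τ) := by gcongr
        _ = _ := by ring
    · simp [realDensity, hτ, B]

theorem realDensity_pt_mem {δ : ℝ} (hδ : 0 < δ) (w : ℂ) (τ : ℝ) : (realDensity w).pt τ ∈ strip δ :=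
  ofReal_mem_strip hδ (le_max_right _ _)

theorem admissible_realDensity {δ c : ℝ} (hδ : 0 < δ) (hc : 0 < c) {w : ℂ} (hw : 0 < w.re) :
    (realDensity w).Admissible δ c := by
  obtain ⟨B, hB, hle⟩ := exists_bound_realDensity hc hw
  have hm := measurable_realDensity_wt w
  have hp := measurable_realDensity_pt w
  refine ⟨hp, hm, realDensity_pt_mem hδ w, hB.mono' ?_ (ae_of_all _ fun τ => ?_)⟩
  · refine Measurable.aestronglyMeasurable ?_
    have hp' : Measurable fun τ => ((realDensity w).pt τ).re := Complex.measurable_re.comp hp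
    fun_prop
  · rw [Real.norm_of_nonneg (by positivity)]
    exact hle.self_of_nhds τ

theorem admissible_mellinDensity {ε δ c : ℝ} (hε : 0 < ε) (hδ : ε < δ) (hc : 0 < c) (w : ℂ) :
    (mellinDensity ε w).Admissible δ c := by
  unfold mellinDensity
  split_ifs with h
  · exact admissible_realDensity (hε.trans hδ) hc h
  · exact (admissible_hankelDensity hε hδ hc w).scale _

theorem Density.Admissible.integrable_mul {D : Density} {δ c : ℝ} (hD : D.Admissible δ c)
    {f : ℂ → ℂ} (hf : IsDecayingOne δ c f) : Integrable fun τ => D.wt τ * f (D.pt τ) := by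
  obtain ⟨C, hC⟩ := hf.bound
  refine (hD.integrable.const_mul C).mono' ?_ (ae_of_all _ fun τ => ?_)
  · exact (hD.measurable_wt.mul (measurable_comp_of_continuousOn hf.diff.continuousOn
      hD.measurable_pt hD.mem)).aestronglyMeasurable
  · rw [norm_mul]
    calc _ ≤ ‖D.wt τ‖ * (C * Real.exp (-c * (D.pt τ).re)) := by
          gcongr; exact hC _ (hD.mem τ)
      _ = _ := by ring

theorem Density.eval_scale (a : ℂ) (D : Density) (f : ℂ → ℂ) :
    (D.scale a).eval f = a * D.eval f := by
  simp only [Density.eval, Density.scale, mul_assoc]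
  exact integral_const_mul _ _

theorem cpow_eq_exp_log {t : ℝ} (ht : 0 < t) (w : ℂ) :
    (t : ℂ) ^ w = Complex.exp (w * (Real.log t : ℂ)) := by
  rw [Complex.cpow_def_of_ne_zero (Complex.ofReal_ne_zero.mpr ht.ne'), Complex.ofReal_log ht.le,
    mul_comm]

/-! ### Collapsing the Hankel contour onto the positive axis -/

/-- The circular part of the Hankel integral. -/
def circlePart (w : ℂ) (f : ℂ → ℂ) (ε : ℝ) : ℂ :=
  ∫ y in (0 : ℝ)..2 * Real.pi, Complex.exp (w * (Real.log ε + y * Complex.I)) *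
    f (Complex.exp (Real.log ε + y * Complex.I))

section

variable {δ c : ℝ} {f : ℂ → ℂ}

theorem integrableOn_cpow_mul (hf : IsDecayingOne δ c f) (hc : 0 < c) {ε : ℝ} (hε : 0 < ε)
    (hδ : ε < δ) (w : ℂ) : IntegrableOn (fun t : ℝ => (t : ℂ) ^ (w - 1) * f t) (Ioi ε) := by
  have h := (admissible_hankelDensity hε hδ hc w).integrable_mul hf
  have h1 := (h.comp_sub_left ε).integrableOn (s := Ioi ε)
  refine (h1.neg).congr_fun (fun t ht => ?_) measurableSet_Ioi
  have ht' : ε - t < 0 := sub_neg.mpr ht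
  have ht0 : 0 < t := hε.trans ht
  simp only [hankelDensity, hankelPow, hankelLog, hankelVelocity, hankelPoint, if_pos ht',
    sub_sub_cancel, Pi.neg_apply]
  rw [cpow_eq_exp_log ht0]
  ring

/-- The Hankel integral, split into the two rays and the circle. -/
theorem hankelDensity_eval (hf : IsDecayingOne δ c f) (hc : 0 < c) {ε : ℝ} (hε : 0 < ε)
    (hδ : ε < δ) (w : ℂ) : (hankelDensity ε w).eval f =
      (Complex.exp (2 * Real.pi * Complex.I * w) - 1) *
        (∫ t : ℝ in Ioi ε, (t : ℂ) ^ (w - 1) * f t) + Complex.I * circlePart w f ε := by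
  have hpi := Real.pi_pos
  have h := (admissible_hankelDensity hε hδ hc w).integrable_mul hf
  set g : ℝ → ℂ := fun τ => (hankelDensity ε w).wt τ * f ((hankelDensity ε w).pt τ) with hg
  have hsplit : (hankelDensity ε w).eval f =
      (∫ τ in Iio 0, g τ) + (∫ τ in Icc 0 (2 * Real.pi), g τ) + ∫ τ in Ioi (2 * Real.pi), g τ := by
    rw [Density.eval, ← setIntegral_union _ measurableSet_Icc h.integrableOn h.integrableOn,
      ← setIntegral_union _ measurableSet_Ioi h.integrableOn h.integrableOn]
    · rw [Iio_union_Icc_eq_Iic (by positivity), Iic_union_Ioi, setIntegral_univ]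
    · rw [Iio_union_Icc_eq_Iic (by positivity)]
      exact Iic_disjoint_Ioi le_rfl
    · exact disjoint_left.mpr fun x hx hx' => not_lt.mpr hx'.1 hx
  -- Substitution `t = ε - τ`; the sign is the velocity `-1` of the incoming ray.
  have h1 : ∫ τ in Iio 0, g τ = -∫ t : ℝ in Ioi ε, (t : ℂ) ^ (w - 1) * f t := by
    rw [← integral_indicator measurableSet_Iio, ← integral_indicator measurableSet_Ioi,
      ← integral_neg, ← integral_sub_left_eq_self _ volume ε]
    congr 1
    funext t
    by_cases ht : ε < t
    · have ht' : ε - t < 0 := sub_neg.mpr ht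
      have ht0 : 0 < t := hε.trans ht
      rw [indicator_of_mem (mem_Iio.mpr ht'), indicator_of_mem (mem_Ioi.mpr ht)]
      simp only [hg, hankelDensity, hankelPow, hankelLog, hankelVelocity, hankelPoint, if_pos ht',
        sub_sub_cancel]
      rw [cpow_eq_exp_log ht0]
      ring
    · rw [indicator_of_notMem (by simpa using ht), indicator_of_notMem (by simpa using ht)]
      simp
  -- Here the logarithm has gained `2πi`, which multiplies `t^{w-1}` by `e^{2πi(w-1)} = e^{2πiw}`.
  have h3 : ∫ τ in Ioi (2 * Real.pi), g τ =
      Complex.exp (2 * Real.pi * Complex.I * w) * ∫ t : ℝ in Ioi ε, (t : ℂ) ^ (w - 1) * f t := by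
    rw [← integral_const_mul, ← integral_indicator measurableSet_Ioi,
      ← integral_indicator measurableSet_Ioi,
      ← integral_add_right_eq_self ((Ioi (2 * Real.pi)).indicator g) (2 * Real.pi - ε)]
    congr 1
    funext t
    by_cases ht : ε < t
    · have ht0 : 0 < t := hε.trans ht
      have e1 : 2 * Real.pi < t + (2 * Real.pi - ε) := by linarith
      have e2 : ¬ t + (2 * Real.pi - ε) < 0 := by linarith
      have e3 : ε + (t + (2 * Real.pi - ε) - 2 * Real.pi) = t := by ring
      rw [indicator_of_mem (mem_Ioi.mpr e1), indicator_of_mem (mem_Ioi.mpr ht)]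
      simp only [hg, hankelDensity, hankelPow, hankelLog, hankelVelocity, hankelPoint, if_neg e2,
        if_neg (not_le.mpr e1), e3]
      rw [cpow_eq_exp_log ht0, mul_add, Complex.exp_add, sub_mul w 1 (2 * Real.pi * Complex.I),
        one_mul, Complex.exp_sub, Complex.exp_two_pi_mul_I, div_one, mul_one,
        mul_comm w (2 * Real.pi * Complex.I)]
      ring
    · have ht' : t + (2 * Real.pi - ε) ∉ Ioi (2 * Real.pi) := by
        rw [mem_Ioi]
        linarith
      rw [indicator_of_notMem ht', indicator_of_notMem (by simpa using ht)]
  have h2 : ∫ τ in Icc 0 (2 * Real.pi), g τ = Complex.I * circlePart w f ε := by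
    rw [integral_Icc_eq_integral_Ioc, ← intervalIntegral.integral_of_le (by positivity), circlePart,
      ← intervalIntegral.integral_const_mul]
    refine intervalIntegral.integral_congr fun y hy => ?_
    rw [uIcc_of_le (by positivity)] at hy
    have he : (ε : ℂ) = Complex.exp (Real.log ε : ℂ) := by
      rw [← Complex.ofReal_exp, Real.exp_log hε]
    simp only [hg, hankelDensity, hankelPow, hankelLog, hankelVelocity, hankelPoint,
      if_neg (not_lt.mpr hy.1), if_pos hy.2]
    rw [he, ← Complex.exp_add, sub_mul, one_mul,
      Complex.exp_sub]
    field_simp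
  rw [hsplit, h1, h2, h3]
  ring

theorem exp_mem_strip {ε : ℝ} (hε : 0 < ε) (hδ : ε < δ) {l : ℂ} (hl : l.re ≤ Real.log ε) :
    Complex.exp l ∈ strip δ := by
  refine mem_strip_of_norm_lt ?_
  rw [Complex.norm_exp]
  calc Real.exp l.re ≤ Real.exp (Real.log ε) := Real.exp_le_exp.mpr hl
    _ < δ := by rwa [Real.exp_log hε]

/-- Cauchy's theorem for the slit annulus, in logarithmic coordinates. -/
theorem circlePart_sub (hf : IsDecayingOne δ c f) {ε ε' : ℝ} (hε' : 0 < ε')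
    (hle : ε' ≤ ε) (hδ : ε < δ) (w : ℂ) :
    Complex.I * circlePart w f ε - Complex.I * circlePart w f ε' =
      (Complex.exp (2 * Real.pi * Complex.I * w) - 1) *
        ∫ t : ℝ in ε'..ε, (t : ℂ) ^ (w - 1) * f t := by
  have hε : 0 < ε := hε'.trans_le hle
  have hlog : Real.log ε' ≤ Real.log ε := Real.log_le_log hε' hle
  have hrect := Complex.integral_boundary_rect_eq_zero_of_differentiableOn
    (fun l : ℂ => Complex.exp (w * l) * f (Complex.exp l)) (Real.log ε' : ℂ)
    ((Real.log ε : ℂ) + (2 * Real.pi : ℝ) * Complex.I) ?_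
  · simp only [Complex.ofReal_re, Complex.ofReal_im, Complex.add_re, Complex.add_im,
      Complex.mul_re, Complex.mul_im, Complex.I_re, Complex.I_im, mul_zero, mul_one, zero_add,
      add_zero, zero_mul, Complex.ofReal_zero, sub_self, smul_eq_mul] at hrect
    -- The slit annulus is the image of a rectangle of height `2π` under `exp`; its top edge carries
    -- `e^{2πiw}` times the integrand of its bottom edge.
    have hper : ∀ x : ℝ, Complex.exp (w * (x + (2 * Real.pi : ℝ) * Complex.I)) *
        f (Complex.exp (x + (2 * Real.pi : ℝ) * Complex.I)) =
        Complex.exp (2 * Real.pi * Complex.I * w) * (Complex.exp (w * x) * f (Complex.exp x)) := by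
      intro x
      have h1 : Complex.exp ((2 * Real.pi : ℝ) * Complex.I) = 1 := by
        push_cast; exact Complex.exp_two_pi_mul_I
      rw [Complex.exp_add, h1, mul_one, mul_add, Complex.exp_add]
      push_cast
      rw [mul_comm w (2 * Real.pi * Complex.I)]
      ring
    simp only [hper, intervalIntegral.integral_const_mul] at hrect
    have hsub : ∫ x in Real.log ε'..Real.log ε, Complex.exp (w * x) * f (Complex.exp x) =
        ∫ t : ℝ in ε'..ε, (t : ℂ) ^ (w - 1) * f t := by
      have hcv := intervalIntegral.integral_deriv_smul_comp' (a := Real.log ε') (b := Real.log ε)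
        (f := Real.exp) (f' := Real.exp) (g := fun t : ℝ => (t : ℂ) ^ (w - 1) * f t)
        (fun x _ => Real.hasDerivAt_exp x) Real.continuous_exp.continuousOn ?_
      · rw [Real.exp_log hε, Real.exp_log hε'] at hcv
        rw [← hcv]
        congr 1
        funext x
        simp only [Function.comp, Complex.real_smul]
        rw [cpow_eq_exp_log (Real.exp_pos x), Real.log_exp, Complex.ofReal_exp, sub_mul, one_mul,
          Complex.exp_sub]
        field_simp
      · have hpos : ∀ t ∈ Real.exp '' uIcc (Real.log ε') (Real.log ε), 0 < t := by
          rintro t ⟨x, -, rfl⟩; exact Real.exp_pos x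
        intro t ht
        have ht0 := hpos t ht
        refine ContinuousAt.continuousWithinAt (ContinuousAt.mul ?_ ?_)
        · exact (Complex.continuousAt_ofReal_cpow_const _ _ (Or.inr ht0.ne'))
        · have hts : (t : ℂ) ∈ strip δ := ofReal_mem_strip (hε.trans hδ) ht0.le
          exact ContinuousAt.comp (f := fun t : ℝ => (t : ℂ))
            (hf.diff.continuousOn.continuousAt ((isOpen_strip δ).mem_nhds hts))
            Complex.continuous_ofReal.continuousAt
    rw [hsub] at hrect
    simp only [circlePart]
    linear_combination hrect
  · intro l hl
    have hre : l.re ≤ Real.log ε := by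
      have := hl.1
      simp only [Complex.ofReal_re, Complex.add_re, Complex.mul_re, Complex.I_re, Complex.I_im,
        mul_zero, Complex.ofReal_im, add_zero, mul_one, sub_self, mem_preimage,
        uIcc_of_le hlog] at this
      exact this.2
    refine DifferentiableAt.differentiableWithinAt (DifferentiableAt.mul (by fun_prop) ?_)
    exact ((hf.diff _ (exp_mem_strip hε hδ hre)).differentiableAt
      ((isOpen_strip δ).mem_nhds (exp_mem_strip hε hδ hre))).comp l (by fun_prop)

theorem integral_Ioi_eq_add (hf : IsDecayingOne δ c f) (hc : 0 < c) {ε ε' : ℝ} (hε' : 0 < ε')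
    (hle : ε' ≤ ε) (hδ : ε < δ) (w : ℂ) :
    ∫ t : ℝ in Ioi ε', (t : ℂ) ^ (w - 1) * f t =
      (∫ t : ℝ in ε'..ε, (t : ℂ) ^ (w - 1) * f t) +
        ∫ t : ℝ in Ioi ε, (t : ℂ) ^ (w - 1) * f t := by
  have h := integrableOn_cpow_mul hf hc hε' (hle.trans_lt hδ) w
  rw [intervalIntegral.integral_of_le hle, ← setIntegral_union _ measurableSet_Ioi
    (h.mono_set Ioc_subset_Ioi_self) (h.mono_set (Ioi_subset_Ioi hle)), Ioc_union_Ioi_eq_Ioi hle]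
  exact disjoint_left.mpr fun x hx hx' => not_lt.mpr hx.2 hx'

/-- The change of the circular part cancels the segment gained on the two rays. -/
theorem hankelDensity_eval_eq_of_le (hf : IsDecayingOne δ c f) (hc : 0 < c) {ε ε' : ℝ}
    (hε' : 0 < ε') (hle : ε' ≤ ε) (hδ : ε < δ) (w : ℂ) :
    (hankelDensity ε w).eval f = (hankelDensity ε' w).eval f := by
  rw [hankelDensity_eval hf hc (hε'.trans_le hle) hδ,
    hankelDensity_eval hf hc hε' (hle.trans_lt hδ), integral_Ioi_eq_add hf hc hε' hle hδ]
  linear_combination circlePart_sub hf hε' hle hδ w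

/-- On the circle `|x^w| ≤ ε^{Re w} e^{2π|Im w|}` and `f` is bounded, so the integral is `O(ε^{Re
w})`. -/
theorem tendsto_circlePart (hf : IsDecayingOne δ c f) (hc : 0 < c) (hδ : 0 < δ) {w : ℂ}
    (hw : 0 < w.re) : Tendsto (circlePart w f) (𝓝[>] 0) (𝓝 0) := by
  have hpi := Real.pi_pos
  obtain ⟨C, hC⟩ := hf.bound
  have hlim : Tendsto (fun ε : ℝ => ε ^ w.re * (Real.exp (2 * Real.pi * |w.im|) *
      (|C| * Real.exp (c * δ)) * (2 * Real.pi))) (𝓝[>] 0) (𝓝 0) := by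
    have h1 : Tendsto (fun ε : ℝ => ε ^ w.re) (𝓝[>] 0) (𝓝 0) := by
      have := (Real.continuousAt_rpow_const 0 w.re (Or.inr hw.le)).tendsto
      rw [Real.zero_rpow hw.ne'] at this
      exact this.mono_left nhdsWithin_le_nhds
    simpa using h1.mul_const _
  refine squeeze_zero_norm' ?_ hlim
  filter_upwards [Ioo_mem_nhdsGT hδ] with ε hε
  have hb := intervalIntegral.norm_integral_le_of_norm_le_const (a := 0) (b := 2 * Real.pi)
    (C := ε ^ w.re * (Real.exp (2 * Real.pi * |w.im|) * (|C| * Real.exp (c * δ))))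
    (f := fun y : ℝ => Complex.exp (w * (Real.log ε + y * Complex.I)) *
      f (Complex.exp (Real.log ε + y * Complex.I))) ?_
  · refine hb.trans_eq ?_
    rw [sub_zero, abs_of_pos Real.two_pi_pos]
    ring
  · intro y hy
    rw [uIoc_of_le (by positivity)] at hy
    have hmem : Complex.exp ((Real.log ε : ℂ) + y * Complex.I) ∈ strip δ :=
      exp_mem_strip hε.1 hε.2 (by simp)
    rw [norm_mul, Complex.norm_exp, ← mul_assoc]
    refine mul_le_mul ?_ ((hC _ hmem).trans ?_) (norm_nonneg _) (by
      have := Real.rpow_nonneg hε.1.le w.re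
      positivity)
    · rw [Real.rpow_def_of_pos hε.1, ← Real.exp_add]
      refine Real.exp_le_exp.mpr ?_
      simp only [Complex.mul_re, Complex.add_re, Complex.ofReal_re, Complex.I_re, mul_zero,
        Complex.ofReal_im, Complex.I_im, mul_one, sub_self, add_zero, Complex.add_im,
        Complex.mul_im, zero_add]
      have h1 : -(w.im * y) ≤ |w.im| * y := by
        have := mul_le_mul_of_nonneg_right (neg_abs_le w.im) hy.1.le
        linarith
      have h2 : |w.im| * y ≤ |w.im| * (2 * Real.pi) :=
        mul_le_mul_of_nonneg_left hy.2 (abs_nonneg _)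
      linarith
    · refine mul_le_mul (le_abs_self C) (Real.exp_le_exp.mpr ?_) (Real.exp_pos _).le (abs_nonneg C)
      nlinarith [hmem.1]

theorem realDensity_eval (w : ℂ) (f : ℂ → ℂ) :
    (realDensity w).eval f =
      (Complex.Gamma w)⁻¹ * ∫ t : ℝ in Ioi 0, (t : ℂ) ^ (w - 1) * f t := by
  rw [Density.eval, ← integral_const_mul, ← integral_indicator measurableSet_Ioi]
  congr 1
  funext t
  by_cases ht : 0 < t
  · rw [indicator_of_mem (mem_Ioi.mpr ht)]
    simp only [realDensity, if_pos ht, max_eq_left ht.le]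
    ring
  · rw [indicator_of_notMem (by simpa using ht)]
    simp [realDensity, ht]

theorem integrableOn_cpow_mul_zero (hf : IsDecayingOne δ c f) (hc : 0 < c) (hδ : 0 < δ) {w : ℂ}
    (hw : 0 < w.re) : IntegrableOn (fun t : ℝ => (t : ℂ) ^ (w - 1) * f t) (Ioi 0) := by
  have h := ((admissible_realDensity hδ hc hw).integrable_mul hf).const_mul (Complex.Gamma w)
  refine (h.integrableOn (s := Ioi 0)).congr_fun (fun t ht => ?_) measurableSet_Ioi
  have ht : 0 < t := ht
  have hG := Complex.Gamma_ne_zero_of_re_pos hw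
  simp only [realDensity, if_pos ht, max_eq_left ht.le]
  field_simp

/-- For `Re w > 0` the Hankel integral collapses onto the positive real axis. -/
theorem hankelDensity_eval_of_re_pos (hf : IsDecayingOne δ c f) (hc : 0 < c) {ε : ℝ} (hε : 0 < ε)
    (hδ : ε < δ) {w : ℂ} (hw : 0 < w.re) : (hankelDensity ε w).eval f =
      (Complex.exp (2 * Real.pi * Complex.I * w) - 1) *
        ∫ t : ℝ in Ioi 0, (t : ℂ) ^ (w - 1) * f t := by
  have hδ0 : 0 < δ := hε.trans hδ
  have h1 : Tendsto (fun ε' : ℝ => ∫ t : ℝ in Ioi ε', (t : ℂ) ^ (w - 1) * f t) (𝓝[>] 0)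
      (𝓝 (∫ t : ℝ in Ioi 0, (t : ℂ) ^ (w - 1) * f t)) := by
    have := (aecover_Ioi_of_Ioi (μ := volume) (A := (0 : ℝ)) (a := id) (l := 𝓝[>] (0 : ℝ))
      nhdsWithin_le_nhds).integral_tendsto_of_countably_generated
      (integrableOn_cpow_mul_zero hf hc hδ0 hw)
    refine this.congr' ?_
    filter_upwards [self_mem_nhdsWithin] with ε' hε'
    have hε' : 0 < ε' := hε'
    rw [Measure.restrict_restrict measurableSet_Ioi]
    congr 2
    rw [id, Ioi_inter_Ioi, sup_of_le_left hε'.le]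
  have h2 := (h1.const_mul (Complex.exp (2 * Real.pi * Complex.I * w) - 1)).add
    ((tendsto_circlePart hf hc hδ0 hw).const_mul Complex.I)
  rw [mul_zero, add_zero] at h2
  refine tendsto_nhds_unique (tendsto_const_nhds.congr' ?_) h2
  filter_upwards [Ioo_mem_nhdsGT hε] with ε' hε'
  rw [hankelDensity_eval_eq_of_le hf hc hε'.1 hε'.2.le hδ,
    hankelDensity_eval hf hc hε'.1 (hε'.2.trans hδ)]

end

/-! ### The factor (e^{2πiw} - 1)Γ(w) and the continued Mellin functional -/

theorem exp_two_pi_I_mul_sub_one (w : ℂ) :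
    Complex.exp (2 * Real.pi * Complex.I * w) - 1 =
      2 * Complex.I * Complex.exp (Real.pi * Complex.I * w) * Complex.sin (Real.pi * w) := by
  have h1 : Complex.exp (2 * Real.pi * Complex.I * w) =
      Complex.exp (Real.pi * Complex.I * w) * Complex.exp (Real.pi * Complex.I * w) := by
    rw [← Complex.exp_add]; ring_nf
  have h2 :
      Complex.exp (Real.pi * Complex.I * w) * Complex.exp (-(Real.pi * Complex.I * w)) = 1 := by
    rw [← Complex.exp_add, add_neg_cancel, Complex.exp_zero]
  have h3 : (Real.pi : ℂ) * w * Complex.I = Real.pi * Complex.I * w := by ring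
  rw [Complex.sin, h1, neg_mul, h3]
  linear_combination (Complex.exp (Real.pi * Complex.I * w) ^ 2 -
    Complex.exp (Real.pi * Complex.I * w) * Complex.exp (-(Real.pi * Complex.I * w))) *
      Complex.I_sq + h2

/-- `hankelFactor w = (e^{2πiw} - 1) Γ(w)` away from the poles of `Γ`. -/
theorem hankelFactor_eq {w : ℂ} (hw : ∀ n : ℕ, w ≠ -n) :
    hankelFactor w = (Complex.exp (2 * Real.pi * Complex.I * w) - 1) * Complex.Gamma w := by
  have hpi : (Real.pi : ℂ) ≠ 0 := Complex.ofReal_ne_zero.mpr Real.pi_ne_zero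
  have hrefl := Complex.Gamma_mul_Gamma_one_sub w
  rw [hankelFactor, exp_two_pi_I_mul_sub_one]
  by_cases hs : Complex.sin (Real.pi * w) = 0
  · rw [hs, div_zero, mul_eq_zero] at hrefl
    rw [hrefl.resolve_left (Complex.Gamma_ne_zero hw), hs]
    simp
  · have hG : Complex.Gamma (1 - w) ≠ 0 := by
      intro h
      rw [h, mul_zero] at hrefl
      exact div_ne_zero hpi hs hrefl.symm
    rw [eq_div_iff hs] at hrefl
    rw [← div_eq_mul_inv, div_eq_iff hG]
    linear_combination (-(2 * Complex.I * Complex.exp (Real.pi * Complex.I * w))) * hrefl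

/-- The zeros of `1 / Γ(1 - w)` are `w = 1, 2, …`. So division by the factor is harmless on `Re w <
1`, a half-plane that overlaps the domain `Re w > 0` of the real integral. -/
theorem hankelFactor_ne_zero {w : ℂ} (hw : w.re < 1) : hankelFactor w ≠ 0 := by
  have : Complex.Gamma (1 - w) ≠ 0 := Complex.Gamma_ne_zero_of_re_pos (by simpa using hw)
  simp [hankelFactor, Real.pi_ne_zero, this]

theorem ne_neg_nat_of_re_pos {w : ℂ} (hw : 0 < w.re) (n : ℕ) : w ≠ -n := by
  rintro rfl
  simp only [Complex.neg_re, Complex.natCast_re, Left.neg_pos_iff] at hw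
  exact absurd hw (not_lt.mpr n.cast_nonneg)

theorem differentiable_hankelFactor : Differentiable ℂ hankelFactor := by
  unfold hankelFactor
  refine Differentiable.mul (by fun_prop) ?_
  exact Complex.differentiable_one_div_Gamma.comp (by fun_prop)

section

variable {δ c : ℝ} {ε ε' : ℝ}

theorem agree_hankelDensity (hc : 0 < c) (hε : 0 < ε) (hδ : ε < δ) (hε' : 0 < ε') (hδ' : ε' < δ)
    (w : ℂ) : Density.Agree δ c (hankelDensity ε w) (hankelDensity ε' w) := by
  intro f hf
  rcases le_total ε ε' with h | h
  · exact (hankelDensity_eval_eq_of_le hf hc hε h hδ' w).symm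
  · exact hankelDensity_eval_eq_of_le hf hc hε' h hδ w

theorem agree_hankelDensity_realDensity (hc : 0 < c) (hε : 0 < ε) (hδ : ε < δ) {w : ℂ}
    (hw : 0 < w.re) :
    Density.Agree δ c (hankelDensity ε w) ((realDensity w).scale (hankelFactor w)) := by
  intro f hf
  rw [Density.eval_scale, realDensity_eval, hankelDensity_eval_of_re_pos hf hc hε hδ hw,
    hankelFactor_eq (ne_neg_nat_of_re_pos hw)]
  have := Complex.Gamma_ne_zero_of_re_pos hw
  field_simp

/-- The continued Mellin functional times `(e^{2πiw} - 1) Γ(w)` is the Hankel functional. -/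
theorem agree_scale_mellinDensity (hc : 0 < c) (hε : 0 < ε) (hδ : ε < δ) (hε' : 0 < ε')
    (hδ' : ε' < δ) (w : ℂ) :
    Density.Agree δ c ((mellinDensity ε w).scale (hankelFactor w)) (hankelDensity ε' w) := by
  intro f hf
  unfold mellinDensity
  split_ifs with h
  · exact (agree_hankelDensity_realDensity hc hε' hδ' h f hf).symm
  · rw [Density.eval_scale, Density.eval_scale, mul_inv_cancel_left₀
      (hankelFactor_ne_zero (by linarith)), agree_hankelDensity hc hε hδ hε' hδ' w f hf]

theorem agree_mellinDensity_hankelDensity (hc : 0 < c) (hε : 0 < ε) (hδ : ε < δ) {w : ℂ}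
    (hw : w.re < 1) :
    Density.Agree δ c (mellinDensity ε w) ((hankelDensity ε w).scale (hankelFactor w)⁻¹) := by
  intro f hf
  rw [Density.eval_scale, ← agree_scale_mellinDensity hc hε hδ hε hδ w f hf, Density.eval_scale,
    inv_mul_cancel_left₀ (hankelFactor_ne_zero hw)]

theorem agree_mellinDensity (hc : 0 < c) (hε : 0 < ε) (hδ : ε < δ) (hε' : 0 < ε')
    (hδ' : ε' < δ) (w : ℂ) :
    Density.Agree δ c (mellinDensity ε w) (mellinDensity ε' w) := by
  intro f hf
  unfold mellinDensity
  split_ifs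
  · rfl
  · rw [Density.eval_scale, Density.eval_scale, agree_hankelDensity hc hε hδ hε' hδ' w f hf]

theorem differentiable_hankelDensity_wt (ε τ : ℝ) :
    Differentiable ℂ fun w => (hankelDensity ε w).wt τ := by
  simp only [hankelDensity, hankelPow]
  fun_prop

theorem analyticOnNhd_hankelDensity_eval {f : ℂ → ℂ} (hf : IsDecayingOne δ c f) (hc : 0 < c)
    (hε : 0 < ε) (hδ : ε < δ) :
    AnalyticOnNhd ℂ (fun w => (hankelDensity ε w).eval f) univ := by
  refine analyticOnNhd_integral_of_dominated isOpen_univ (fun w _ =>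
    ((admissible_hankelDensity hε hδ hc w).integrable_mul hf).aestronglyMeasurable)
    (fun τ =>
      ((differentiable_hankelDensity_wt ε τ).mul_const (f (hankelPoint ε τ))).differentiableOn)
    fun w₀ _ => ?_
  obtain ⟨B, hB, hle⟩ := exists_bound_hankelDensity hε hc (‖w₀‖ + 1)
  obtain ⟨C, hC⟩ := hf.bound
  refine ⟨fun τ => |C| * B τ, hB.const_mul _, ?_⟩
  filter_upwards [continuous_norm.continuousAt.eventually_lt_const (lt_add_one ‖w₀‖)] with w hw τ
  have h1 := hC _ (hankelPoint_mem_strip hε hδ τ)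
  rw [norm_mul]
  calc _ ≤ ‖(hankelDensity ε w).wt τ‖ * (|C| * Real.exp (-c * (hankelPoint ε τ).re)) := by
        refine mul_le_mul_of_nonneg_left (h1.trans ?_) (norm_nonneg _)
        gcongr
        exact le_abs_self C
    _ = |C| * (‖(hankelDensity ε w).wt τ‖ * Real.exp (-c * (hankelPoint ε τ).re)) := by ring
    _ ≤ _ := by gcongr; exact hle w hw.le τ

theorem isDecayingOne_exp_neg_mul {a : ℝ} (ha : c ≤ a) :
    IsDecayingOne δ c fun x => Complex.exp (-(a * x)) := by
  refine ⟨Differentiable.differentiableOn (by fun_prop), Real.exp ((a - c) * δ), fun x hx => ?_⟩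
  rw [Complex.norm_exp, ← Real.exp_add]
  refine Real.exp_le_exp.mpr ?_
  simp only [Complex.neg_re, Complex.mul_re, Complex.ofReal_re, Complex.ofReal_im, zero_mul,
    sub_zero]
  nlinarith [hx.1]

/-- The continued Mellin functional sends `e^{-ax}` to `a^{-w}`. -/
theorem mellinDensity_eval_exp {a : ℝ} (hc : 0 < c) (hca : c ≤ a) (hε : 0 < ε) (hδ : ε < δ)
    (w : ℂ) : (mellinDensity ε w).eval (fun x => Complex.exp (-(a * x))) = ((a : ℂ) ^ w)⁻¹ := by
  have ha : 0 < a := hc.trans_le hca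
  have ha' : (a : ℂ) ≠ 0 := Complex.ofReal_ne_zero.mpr ha.ne'
  have hf := isDecayingOne_exp_neg_mul (δ := δ) hca
  have hpos : ∀ w : ℂ, 0 < w.re →
      (realDensity w).eval (fun x => Complex.exp (-(a * x))) = ((a : ℂ) ^ w)⁻¹ := by
    intro w hw
    have := Complex.Gamma_ne_zero_of_re_pos hw
    rw [realDensity_eval, Complex.integral_cpow_mul_exp_neg_mul_Ioi hw ha, one_div,
      Complex.inv_cpow _ _ (by rw [Complex.arg_ofReal_of_nonneg ha.le]; exact Real.pi_ne_zero.symm)]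
    field_simp
  unfold mellinDensity
  split_ifs with h
  · exact hpos w h
  -- Outside `Re w > 0`, compare the Hankel integral with `hankelFactor w * a^{-w}`: both are entire
  -- and they agree near `w = 1`.
  · have hpow : Differentiable ℂ fun w : ℂ => hankelFactor w * ((a : ℂ) ^ w)⁻¹ := by
      refine differentiable_hankelFactor.mul (Differentiable.inv ?_ fun w => ?_)
      · exact fun w => differentiableAt_id.const_cpow (Or.inl ha')
      · simp [Complex.cpow_eq_zero_iff, ha']
    have heq := AnalyticOnNhd.eq_of_eventuallyEq (z₀ := (1 : ℂ))
      (analyticOnNhd_hankelDensity_eval hf hc hε hδ)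
      (Complex.analyticOnNhd_univ_iff_differentiable.mpr hpow) ?_
    · have := congrFun heq w
      rw [Density.eval_scale, this, inv_mul_cancel_left₀ (hankelFactor_ne_zero (by linarith))]
    · filter_upwards [Complex.continuous_re.continuousAt.eventually_const_lt
        (show 0 < (1 : ℂ).re by simp)] with w hw
      rw [agree_hankelDensity_realDensity hc hε hδ hw _ hf, Density.eval_scale, hpos w hw]

end

/-! ### The continued Mellin transform in several variables -/

/-- The analytic continuation in `w` of `∏ 1/Γ(w_i) ∫ ∏ t_i^{w_i-1} K(t) dt`. -/
def mellin {ι : Type*} [Fintype ι] (ε : ℝ) (K : (ι → ℂ) → ℂ) (w : ι → ℂ) : ℂ :=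
  tensor (fun i => mellinDensity ε (w i)) K

/-- One of the two densities representing the continued Mellin functional: the real one for
`Re w > 0`, the Hankel one for `Re w < 1`. -/
def branchDensity (ε : ℝ) : Bool → ℂ → Density
  | true, w => realDensity w
  | false, w => (hankelDensity ε w).scale (hankelFactor w)⁻¹

/-- The half-plane where `branchDensity` is used. -/
def branchDomain : Bool → Set ℂ
  | true => {w | 0 < w.re}
  | false => {w | w.re < 1}

theorem isOpen_branchDomain (b : Bool) : IsOpen (branchDomain b) := by
  cases b
  · exact isOpen_lt Complex.continuous_re continuous_const
  · exact isOpen_lt continuous_const Complex.continuous_re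

theorem differentiableOn_branchDensity_wt (ε : ℝ) (b : Bool) (τ : ℝ) :
    DifferentiableOn ℂ (fun w => (branchDensity ε b w).wt τ) (branchDomain b) := by
  cases b
  · refine DifferentiableOn.mul ?_ (differentiable_hankelDensity_wt ε τ).differentiableOn
    exact differentiable_hankelFactor.differentiableOn.inv fun w hw => hankelFactor_ne_zero hw
  · simp only [branchDensity, realDensity]
    split_ifs with h
    · refine DifferentiableOn.mul (Differentiable.differentiableOn fun w => ?_)
        Complex.differentiable_one_div_Gamma.differentiableOn
      exact DifferentiableAt.const_cpow (by fun_prop)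
        (Or.inl (Complex.ofReal_ne_zero.mpr h.ne'))
    · exact differentiableOn_const _

theorem exists_bound_branchDensity {ε c : ℝ} (hε : 0 < ε) (hc : 0 < c) (b : Bool) {w₀ : ℂ}
    (hw₀ : w₀ ∈ branchDomain b) :
    ∃ B : ℝ → ℝ, Integrable B ∧ ∀ᶠ w : ℂ in 𝓝 w₀, ∀ τ,
      ‖(branchDensity ε b w).wt τ‖ * Real.exp (-c * ((branchDensity ε b w).pt τ).re) ≤ B τ := by
  cases b
  · obtain ⟨B, hB, hle⟩ := exists_bound_hankelDensity hε hc (‖w₀‖ + 1)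
    set M := ‖(hankelFactor w₀)⁻¹‖ + 1
    refine ⟨fun τ => M * B τ, hB.const_mul _, ?_⟩
    have h1 : ∀ᶠ w in 𝓝 w₀, ‖(hankelFactor w)⁻¹‖ < M :=
      ((differentiable_hankelFactor.continuous.continuousAt.inv₀
        (hankelFactor_ne_zero hw₀)).norm).eventually_lt_const (lt_add_one _)
    filter_upwards [h1, continuous_norm.continuousAt.eventually_lt_const (lt_add_one ‖w₀‖)]
      with w hw hw' τ
    simp only [branchDensity, Density.scale, norm_mul, mul_assoc]
    exact mul_le_mul hw.le (hle w hw'.le τ) (by positivity) (by positivity)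
  · exact exists_bound_realDensity hc hw₀

section

variable {ι : Type*} [Fintype ι] {δ c ε ε' : ℝ}

theorem admissible_branchDensity (hε : 0 < ε) (hδ : ε < δ) (hc : 0 < c) {b : Bool} {w : ℂ}
    (hw : w ∈ branchDomain b) : (branchDensity ε b w).Admissible δ c := by
  cases b
  · exact (admissible_hankelDensity hε hδ hc w).scale _
  · exact admissible_realDensity (hε.trans hδ) hc hw

theorem agree_mellinDensity_branchDensity (hc : 0 < c) (hε : 0 < ε) (hδ : ε < δ) {b : Bool} {w : ℂ}
    (hw : w ∈ branchDomain b) :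
    Density.Agree δ c (mellinDensity ε w) (branchDensity ε b w) := by
  cases b
  · exact agree_mellinDensity_hankelDensity hc hε hδ hw
  · intro f _
    have hw' : 0 < w.re := hw
    rw [mellinDensity, if_pos hw', branchDensity]

theorem branchDensity_pt (ε : ℝ) (b : Bool) (w : ℂ) :
    (branchDensity ε b w).pt = (branchDensity ε b 0).pt := by
  cases b <;> rfl

/-- The continued Mellin transform is analytic in the exponents and in parameters. -/
theorem analyticOnNhd_mellin {E : Type*} [NormedAddCommGroup E] [NormedSpace ℂ E]
    [FiniteDimensional ℂ E] {V : Set E} (hV : IsOpen V) (hε : 0 < ε) (hδ : ε < δ) (hc : 0 < c)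
    {K : E → (ι → ℂ) → ℂ} (hKd : ∀ y ∈ polyStrip ι δ, DifferentiableOn ℂ (fun x => K x y) V)
    (hK : ∀ x ∈ V, IsDecaying δ c (K x))
    (hKb : ∀ x₀ ∈ V, ∃ C, ∀ᶠ x in 𝓝 x₀, ∀ y ∈ polyStrip ι δ,
      ‖K x y‖ ≤ C * Real.exp (-c * ∑ i, (y i).re)) :
    AnalyticOnNhd ℂ (fun p : (ι → ℂ) × E => mellin ε (K p.2) p.1) (univ ×ˢ V) := by
  rintro ⟨w₀, z₀⟩ ⟨-, hz₀⟩
  -- `mellinDensity` switches representation at `Re w = 0`, so its weight need not be continuous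
  -- there. Near `w₀` each coordinate is assigned one fixed representation, valid on an open
  -- half-plane; `tensor_congr` then transfers analyticity.
  let b : ι → Bool := fun i => decide (0 < (w₀ i).re)
  let U : Set ((ι → ℂ) × E) := (univ.pi fun i => branchDomain (b i)) ×ˢ V
  have hU : IsOpen U := (isOpen_set_pi finite_univ fun i _ => isOpen_branchDomain (b i)).prod hV
  have hmem : (w₀, z₀) ∈ U := by
    refine ⟨fun i _ => ?_, hz₀⟩
    by_cases h : 0 < (w₀ i).re
    · have : b i = true := decide_eq_true h
      simpa [this, branchDomain] using h
    · have : b i = false := decide_eq_false h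
      change w₀ i ∈ branchDomain (b i)
      rw [this]
      change (w₀ i).re < 1
      linarith
  have hadm : ∀ p ∈ U, ∀ i, (branchDensity ε (b i) (p.1 i)).Admissible δ c :=
    fun p hp i => admissible_branchDensity hε hδ hc (hp.1 i (mem_univ i))
  have han := analyticOnNhd_tensor (δ := δ) (c := c) hU (fun i => (branchDensity ε (b i) 0).pt)
    (fun i p => (branchDensity ε (b i) (p.1 i)).wt) (fun p => K p.2)
    (fun i => by
      rw [← branchDensity_pt ε (b i) (w₀ i)]; exact (hadm _ hmem i).measurable_pt)
    (fun i => by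
      rw [← branchDensity_pt ε (b i) (w₀ i)]; exact (hadm _ hmem i).mem)
    (fun i p hp => (hadm p hp i).measurable_wt)
    (fun i τ => (differentiableOn_branchDensity_wt ε (b i) τ).comp
      (Differentiable.differentiableOn (by fun_prop)) fun p hp => hp.1 i (mem_univ i))
    ?_ (fun y hy => (hKd y hy).comp differentiable_snd.differentiableOn fun p hp => hp.2)
    (fun p hp => (hK _ hp.2).diff.continuousOn) ?_
  · refine (han _ hmem).congr ?_
    filter_upwards [hU.mem_nhds hmem] with p hp
    have hD :
        (fun i => (⟨(branchDensity ε (b i) 0).pt, (branchDensity ε (b i) (p.1 i)).wt⟩ : Density))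
        = fun i => branchDensity ε (b i) (p.1 i) := by
      funext i
      rw [← branchDensity_pt ε (b i) (p.1 i)]
    rw [hD, mellin]
    exact (tensor_congr hc.le (fun i => admissible_mellinDensity hε hδ hc _) (hadm p hp)
      (fun i => agree_mellinDensity_branchDensity hc hε hδ (hp.1 i (mem_univ i)))
      (hK _ hp.2)).symm
  · intro p hp i
    obtain ⟨B, hB, hle⟩ := exists_bound_branchDensity (c := c) hε hc (b i) (hp.1 i (mem_univ i))
    refine ⟨B, hB, ?_⟩
    have hcont : ContinuousAt (fun q : (ι → ℂ) × E => q.1 i) p := by fun_prop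
    filter_upwards [hcont.eventually hle] with q hq τ
    rw [← branchDensity_pt ε (b i) (q.1 i)]
    exact hq τ
  · intro p hp
    obtain ⟨C, hC⟩ := hKb p.2 hp.2
    exact ⟨C, continuous_snd.continuousAt.eventually hC⟩

/-- Independence of the radius lets locally chosen contours be glued into one function. -/
theorem mellin_congr_radius (hε : 0 < ε) (hδ : ε < δ) (hε' : 0 < ε') (hδ' : ε' < δ) (hc : 0 < c)
    {K : (ι → ℂ) → ℂ} (hK : IsDecaying δ c K) (w : ι → ℂ) : mellin ε K w = mellin ε' K w :=
  tensor_congr hc.le (fun _ => admissible_mellinDensity hε hδ hc _)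
    (fun _ => admissible_mellinDensity hε' hδ' hc _)
    (fun _ => agree_mellinDensity hc hε hδ hε' hδ' _) hK

theorem tensor_scale (a : ι → ℂ) (D : ι → Density) (K : (ι → ℂ) → ℂ) :
    tensor (fun i => (D i).scale (a i)) K = (∏ i, a i) * tensor D K := by
  rw [tensor, tensor, ← integral_const_mul]
  congr 1
  funext τ
  simp only [tensorIntegrand, Density.scale, Finset.prod_mul_distrib, mul_assoc]

/-- The continued Mellin transform as a multiple Hankel integral. -/
theorem prod_hankelFactor_mul_mellin (hε : 0 < ε) (hδ : ε < δ) (hε' : 0 < ε') (hδ' : ε' < δ)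
    (hc : 0 < c) {K : (ι → ℂ) → ℂ} (hK : IsDecaying δ c K) (w : ι → ℂ) :
    (∏ i, hankelFactor (w i)) * mellin ε K w = tensor (fun i => hankelDensity ε' (w i)) K := by
  rw [mellin, ← tensor_scale]
  exact tensor_congr hc.le (fun _ => (admissible_mellinDensity hε hδ hc _).scale _)
    (fun _ => admissible_hankelDensity hε' hδ' hc _)
    (fun _ => agree_scale_mellinDensity hc hε hδ hε' hδ' _) hK

theorem tensorIntegrand_realDensity (K : (ι → ℂ) → ℂ) (w : ι → ℂ) (t : ι → ℝ) :
    tensorIntegrand (fun i => realDensity (w i)) K t =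
      (univ.pi fun _ : ι => Ioi (0 : ℝ)).indicator (fun t => (∏ i, (Complex.Gamma (w i))⁻¹) *
        ((∏ i, (t i : ℂ) ^ (w i - 1)) * K fun i => (t i : ℂ))) t := by
  by_cases ht : t ∈ univ.pi fun _ : ι => Ioi (0 : ℝ)
  · rw [indicator_of_mem ht]
    have ht' : ∀ i, 0 < t i := fun i => ht i (mem_univ i)
    simp only [tensorIntegrand, realDensity, ht', if_true, max_eq_left (ht' _).le,
      Finset.prod_mul_distrib]
    ring
  · rw [indicator_of_notMem ht]
    simp only [mem_univ_pi, mem_Ioi, not_forall] at ht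
    obtain ⟨i, hi⟩ := ht
    rw [tensorIntegrand, Finset.prod_eq_zero (Finset.mem_univ i), zero_mul]
    simp [realDensity, hi]

theorem measurableSet_pi_Ioi : MeasurableSet (univ.pi fun _ : ι => Ioi (0 : ℝ)) :=
  MeasurableSet.univ_pi fun _ => measurableSet_Ioi

theorem integrableOn_mellin_integrand (hδ : 0 < δ) (hc : 0 < c) {K : (ι → ℂ) → ℂ}
    (hK : IsDecaying δ c K) {w : ι → ℂ} (hw : ∀ i, 0 < (w i).re) :
    IntegrableOn (fun t : ι → ℝ => (∏ i, (t i : ℂ) ^ (w i - 1)) * K fun i => (t i : ℂ))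
      (univ.pi fun _ => Ioi 0) := by
  have h := integrable_tensorIntegrand (fun i => admissible_realDensity hδ hc (hw i)) hK
  have h2 := (integrable_indicator_iff measurableSet_pi_Ioi).mp
    (h.congr (ae_of_all _ (tensorIntegrand_realDensity K w)))
  refine IntegrableOn.congr_fun (h2.const_mul (∏ i, Complex.Gamma (w i))) (fun t _ => ?_)
    measurableSet_pi_Ioi
  have : ∏ i, Complex.Gamma (w i) ≠ 0 :=
    Finset.prod_ne_zero_iff.mpr fun i _ => Complex.Gamma_ne_zero_of_re_pos (hw i)
  simp only [Finset.prod_inv_distrib]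
  rw [mul_inv_cancel_left₀ this]

theorem mellin_of_re_pos (ε : ℝ) (K : (ι → ℂ) → ℂ) {w : ι → ℂ} (hw : ∀ i, 0 < (w i).re) :
    mellin ε K w = (∏ i, (Complex.Gamma (w i))⁻¹) *
      ∫ t in univ.pi fun _ : ι => Ioi (0 : ℝ),
        (∏ i, (t i : ℂ) ^ (w i - 1)) * K fun i => (t i : ℂ) := by
  have h : (fun i => mellinDensity ε (w i)) = fun i => realDensity (w i) := by
    funext i
    rw [mellinDensity, if_pos (hw i)]
  rw [mellin, h, tensor, ← integral_const_mul, ← integral_indicator measurableSet_pi_Ioi]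
  exact integral_congr_ae (ae_of_all _ (tensorIntegrand_realDensity K w))

theorem tensor_prod (D : ι → Density) (f : ι → ℂ → ℂ) :
    tensor D (fun x => ∏ i, f i (x i)) = ∏ i, (D i).eval (f i) := by
  simp only [tensor, tensorIntegrand, ← Finset.prod_mul_distrib, Density.eval]
  exact integral_fintype_prod_volume_eq_prod (fun i τ => (D i).wt τ * f i ((D i).pt τ))

theorem mellin_exp (hε : 0 < ε) (w : ι → ℂ) {a : ι → ℝ} (ha : ∀ i, 0 < a i) :
    mellin ε (fun x => Complex.exp (-∑ i, a i * x i)) w = ∏ i, ((a i : ℂ) ^ w i)⁻¹ := by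
  have h : (fun x : ι → ℂ => Complex.exp (-∑ i, a i * x i)) =
      fun x => ∏ i, Complex.exp (-(a i * x i)) := by
    funext x
    rw [← Complex.exp_sum, Finset.sum_neg_distrib]
  rw [mellin, h, tensor_prod _ fun i x => Complex.exp (-(a i * x))]
  -- Once the integral has factored, each coordinate may use its own decay rate `c = a i`.
  exact Finset.prod_congr rfl fun i _ =>
    mellinDensity_eval_exp (ha i) le_rfl hε (lt_add_one ε) _

end

/-! ### The polylogarithm kernel and its regularity -/

section

variable {r : ℕ}

theorem tailSum_re (x : Fin r → ℂ) (j : Fin r) :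
    (tailSum x j).re = ∑ i ∈ Finset.Ici j, (x i).re := by
  rw [tailSum, Complex.re_sum]

theorem tailSum_im (x : Fin r → ℂ) (j : Fin r) :
    (tailSum x j).im = ∑ i ∈ Finset.Ici j, (x i).im := by
  rw [tailSum, Complex.im_sum]

theorem differentiable_tailSum (j : Fin r) : Differentiable ℂ fun x => tailSum x j := by
  unfold tailSum
  fun_prop

theorem tailSum_zero [NeZero r] (x : Fin r → ℂ) : tailSum x 0 = ∑ i, x i := by
  have : (Finset.Ici (0 : Fin r)) = Finset.univ := by ext; simp
  rw [tailSum, this]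

theorem neg_le_tailSum_re {δ : ℝ} (hδ : 0 < δ) {x : Fin r → ℂ} (hx : x ∈ polyStrip (Fin r) δ)
    (j : Fin r) : -(r * δ) ≤ (tailSum x j).re := by
  rw [mem_polyStrip] at hx
  rw [tailSum_re]
  have h1 : ((Finset.Ici j).card : ℝ) ≤ r := by
    exact_mod_cast (Finset.card_le_univ _).trans_eq (Fintype.card_fin r)
  have h2 := Finset.card_nsmul_le_sum (Finset.Ici j) (fun i => (x i).re) (-δ)
    fun i _ => (hx i).1.le
  rw [nsmul_eq_mul] at h2
  nlinarith

theorem abs_tailSum_im_le {δ : ℝ} (hδ : 0 < δ) {x : Fin r → ℂ} (hx : x ∈ polyStrip (Fin r) δ)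
    (j : Fin r) : |(tailSum x j).im| ≤ r * δ := by
  rw [mem_polyStrip] at hx
  rw [tailSum_im]
  have h1 : ((Finset.Ici j).card : ℝ) ≤ r := by
    exact_mod_cast (Finset.card_le_univ _).trans_eq (Fintype.card_fin r)
  have h2 := Finset.sum_le_card_nsmul (Finset.Ici j) (fun i => |(x i).im|) δ
    fun i _ => (hx i).2.le
  rw [nsmul_eq_mul] at h2
  refine (Finset.abs_sum_le_sum_abs _ _).trans (h2.trans ?_)
  gcongr

/-- The integrand kernel in the integral representation of the multiple polylogarithm. -/
def polylogKernel (b : Fin r → ℕ) (z x : Fin r → ℂ) : ℂ :=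
  ∏ j, z j ^ b j * Complex.exp (-(b j * tailSum x j)) / (1 - z j * Complex.exp (-tailSum x j))

/-- The region `ℂ ∖ ℝ_{≥ 1}`. -/
def slitPlaneOne : Set ℂ := {z | z ∉ ((↑) : ℝ → ℂ) '' Ici 1}

theorem isOpen_slitPlaneOne : IsOpen slitPlaneOne :=
  (Complex.isUniformEmbedding_ofReal.isClosedEmbedding.isClosedMap _ isClosed_Ici).isOpen_compl

/-- For `ζ₀` off `[1, ∞)` the function `1 - ζ₀ q` has no zero on the compact interval `0 ≤ q ≤ 1`.
For `X` near the positive axis `e^{-X}` is close to such a `q`, so the bound survives perturbation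
of both `ζ₀` and `X`. -/
theorem eventually_norm_one_sub_mul_exp_ge {ζ₀ : ℂ} (h : ζ₀ ∈ slitPlaneOne) :
    ∀ᶠ κ : ℝ in 𝓝[>] 0, ∀ᶠ ζ in 𝓝 ζ₀, ∀ X : ℂ, -κ ≤ X.re → |X.im| ≤ κ →
      κ ≤ ‖1 - ζ * Complex.exp (-X)‖ := by
  obtain ⟨q₀, hq₀, hmin⟩ := (isCompact_Icc (a := (0 : ℝ)) (b := 1)).exists_isMinOn
    (nonempty_Icc.mpr zero_le_one) (f := fun q : ℝ => ‖1 - ζ₀ * q‖) (by fun_prop)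
  set m := ‖1 - ζ₀ * q₀‖ with hm
  have hmpos : 0 < m := by
    rw [hm, norm_pos_iff]
    intro h0
    have hq : (q₀ : ℂ) ≠ 0 := by
      intro hq
      rw [hq] at h0
      simp at h0
    have hq' : 0 < q₀ := lt_of_le_of_ne hq₀.1 fun h => hq (by rw [← h]; simp)
    refine h ⟨q₀⁻¹, (one_le_inv₀ hq').mpr hq₀.2, ?_⟩
    rw [Complex.ofReal_inv]
    rw [sub_eq_zero] at h0
    exact inv_eq_of_mul_eq_one_left h0.symm
  -- The bound `1 / 2` ensures `‖X - x‖ ≤ 1` for the estimate of `e^{-(X - x)} - 1`; the other makes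
  -- the error `4κ‖ζ₀‖` less than `m / 4`. Moving `ζ` costs at most another `m / 4`, leaving `m / 2
  -- ≥ κ`.
  have hκ : ∀ᶠ κ : ℝ in 𝓝[>] 0, κ < min (1 / 2) (m / (16 * (‖ζ₀‖ + 1))) :=
    nhdsWithin_le_nhds (gt_mem_nhds (by positivity))
  filter_upwards [hκ, self_mem_nhdsWithin] with κ hκ hκ0
  have hκ0 : 0 < κ := hκ0
  have hκ1 : κ < 1 / 2 := hκ.trans_le (min_le_left _ _)
  have hκ2 : κ * (16 * (‖ζ₀‖ + 1)) < m := by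
    rw [← lt_div_iff₀ (by positivity)]
    exact hκ.trans_le (min_le_right _ _)
  filter_upwards [ball_mem_nhds ζ₀ (show 0 < m / 12 by positivity)] with ζ hζ X hre him
  rw [mem_ball, dist_eq_norm] at hζ
  set x := max X.re 0 with hx
  have hq : Real.exp (-x) ∈ Icc (0 : ℝ) 1 :=
    ⟨(Real.exp_pos _).le, Real.exp_le_one_iff.mpr (by simp [hx])⟩
  have h1 : m ≤ ‖1 - ζ₀ * (Real.exp (-x) : ℂ)‖ := hmin hq
  have hh : ‖X - x‖ ≤ 2 * κ := by
    refine (Complex.norm_le_abs_re_add_abs_im _).trans ?_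
    have : |(X - x).re| ≤ κ := by
      rw [Complex.sub_re, Complex.ofReal_re, abs_le, hx]
      rcases max_cases X.re 0 with ⟨h, h'⟩ | ⟨h, h'⟩ <;> rw [h] <;> constructor <;> linarith
    have h2 : |(X - x).im| ≤ κ := by simpa using him
    linarith
  have h2 : ‖Complex.exp (-X) - (Real.exp (-x) : ℂ)‖ ≤ 4 * κ := by
    have e1 : Complex.exp (-X) = (Real.exp (-x) : ℂ) * Complex.exp (-(X - x)) := by
      rw [Complex.ofReal_exp, ← Complex.exp_add]
      congr 1
      push_cast
      ring
    have e2 := Complex.norm_exp_sub_one_le (x := -(X - x)) (by rw [norm_neg]; linarith)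
    rw [norm_neg] at e2
    rw [e1, ← mul_sub_one, norm_mul, Complex.norm_real, Real.norm_of_nonneg hq.1]
    calc _ ≤ 1 * (2 * ‖X - x‖) := mul_le_mul hq.2 e2 (norm_nonneg _) zero_le_one
      _ ≤ _ := by linarith
  have h3 : ‖Complex.exp (-X)‖ ≤ 3 := by
    have : Complex.exp (-X) = (Complex.exp (-X) - (Real.exp (-x) : ℂ)) + (Real.exp (-x) : ℂ) := by
      ring
    rw [this]
    refine (norm_add_le _ _).trans ?_
    rw [Complex.norm_real, Real.norm_of_nonneg hq.1]
    linarith [hq.2]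
  have h4 : 1 - ζ₀ * (Real.exp (-x) : ℂ) = (1 - ζ * Complex.exp (-X)) +
      (ζ₀ * (Complex.exp (-X) - (Real.exp (-x) : ℂ)) + (ζ - ζ₀) * Complex.exp (-X)) := by ring
  have h5 := norm_add_le (1 - ζ * Complex.exp (-X))
    (ζ₀ * (Complex.exp (-X) - (Real.exp (-x) : ℂ)) + (ζ - ζ₀) * Complex.exp (-X))
  rw [← h4] at h5
  have h6 := norm_add_le (ζ₀ * (Complex.exp (-X) - (Real.exp (-x) : ℂ)))
    ((ζ - ζ₀) * Complex.exp (-X))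
  rw [norm_mul, norm_mul] at h6
  have h7 : ‖ζ₀‖ * ‖Complex.exp (-X) - (Real.exp (-x) : ℂ)‖ ≤ ‖ζ₀‖ * (4 * κ) := by gcongr
  have h8 : ‖ζ - ζ₀‖ * ‖Complex.exp (-X)‖ ≤ m / 12 * 3 :=
    mul_le_mul hζ.le h3 (norm_nonneg _) (by positivity)
  nlinarith

/-- Only one factor `e^{-R_0}` is kept for decay; every remaining power costs at most `e^κ`. With
`R_0` the real part of the full sum of the variables, this single factor gives decay in all of them.
-/
theorem exp_neg_mul_re_le [NeZero r] {κ : ℝ} (hκ : 0 ≤ κ) {l : Fin r → ℕ} (hl : 1 ≤ l 0)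
    {R : Fin r → ℝ} (hR : ∀ j, -κ ≤ R j) (j : Fin r) :
    Real.exp (-(l j * R j)) ≤
      Real.exp κ ^ l j * if j = 0 then Real.exp (-R 0) else 1 := by
  rw [← Real.exp_nat_mul]
  split_ifs with h
  · subst h
    rw [← Real.exp_add]
    refine Real.exp_le_exp.mpr ?_
    have : (1 : ℝ) ≤ l 0 := by exact_mod_cast hl
    nlinarith [hR 0]
  · rw [mul_one]
    refine Real.exp_le_exp.mpr ?_
    have : (0 : ℝ) ≤ l j := Nat.cast_nonneg _
    nlinarith [hR j]

/-- The exponential factors of the kernel decay in the sum of all variables. -/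
theorem norm_prod_exp_tailSum_le [NeZero r] {δ : ℝ} (hδ : 0 < δ) {l : Fin r → ℕ} (hl : 1 ≤ l 0)
    (z : Fin r → ℂ) {x : Fin r → ℂ} (hx : x ∈ polyStrip (Fin r) δ) :
    ∏ j, ‖z j ^ l j * Complex.exp (-(l j * tailSum x j))‖ ≤
      (∏ j, (‖z j‖ * Real.exp (r * δ)) ^ l j) * Real.exp (-1 * ∑ i, (x i).re) := by
  have h0 : (tailSum x 0).re = ∑ i, (x i).re := by rw [tailSum_zero, Complex.re_sum]
  calc ∏ j, ‖z j ^ l j * Complex.exp (-(l j * tailSum x j))‖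
      ≤ ∏ j, ((‖z j‖ * Real.exp (r * δ)) ^ l j *
          if j = 0 then Real.exp (-(tailSum x 0).re) else 1) := by
        refine Finset.prod_le_prod (fun _ _ => norm_nonneg _) fun j _ => ?_
        rw [norm_mul, norm_pow, Complex.norm_exp, mul_pow, mul_assoc]
        refine mul_le_mul_of_nonneg_left ?_ (by positivity)
        have := exp_neg_mul_re_le (κ := r * δ) (by positivity) hl
          (R := fun j => (tailSum x j).re) (neg_le_tailSum_re hδ hx) j
        simpa using this
    _ = _ := by
        rw [Finset.prod_mul_distrib, Finset.prod_ite_eq' Finset.univ (0 : Fin r), h0]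
        simp

/-- On `V`, the kernel of the polylogarithm is holomorphic and uniformly decaying on the half-strip
of width `δ`. -/
structure PolylogKernelRegular (b : Fin r → ℕ) (δ : ℝ) (V : Set (Fin r → ℂ)) : Prop where
  pos : 0 < δ
  isOpen : IsOpen V
  ne_zero : ∀ z ∈ V, ∀ x ∈ polyStrip (Fin r) δ, ∀ j, 1 - z j * Complex.exp (-tailSum x j) ≠ 0
  bound : ∃ C, ∀ z ∈ V, ∀ x ∈ polyStrip (Fin r) δ,
    ‖polylogKernel b z x‖ ≤ C * Real.exp (-1 * ∑ i, (x i).re)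

theorem PolylogKernelRegular.isDecaying {b : Fin r → ℕ} {δ : ℝ} {V : Set (Fin r → ℂ)}
    (h : PolylogKernelRegular b δ V) {z : Fin r → ℂ} (hz : z ∈ V) :
    IsDecaying δ 1 (polylogKernel b z) := by
  refine ⟨differentiableOn_prod fun j => ?_, ?_⟩
  · have := differentiable_tailSum j
    simp only [div_eq_mul_inv]
    refine DifferentiableOn.mul (Differentiable.differentiableOn (by fun_prop))
      (DifferentiableOn.inv (Differentiable.differentiableOn (by fun_prop))
        fun x hx => h.ne_zero z hz x hx j)
  · obtain ⟨C, hC⟩ := h.bound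
    exact ⟨C, hC z hz⟩

theorem PolylogKernelRegular.differentiableOn {b : Fin r → ℕ} {δ : ℝ} {V : Set (Fin r → ℂ)}
    (h : PolylogKernelRegular b δ V) {x : Fin r → ℂ} (hx : x ∈ polyStrip (Fin r) δ) :
    DifferentiableOn ℂ (fun z => polylogKernel b z x) V := by
  refine differentiableOn_prod fun j => ?_
  simp only [div_eq_mul_inv]
  refine DifferentiableOn.mul (Differentiable.differentiableOn (by fun_prop))
    (DifferentiableOn.inv (Differentiable.differentiableOn (by fun_prop))
      fun z hz => h.ne_zero z hz x hx j)

theorem exists_polylogKernelRegular [NeZero r] {b : Fin r → ℕ} (hb : 1 ≤ b 0) {z₀ : Fin r → ℂ}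
    (hz₀ : ∀ j, z₀ j ∈ slitPlaneOne) : ∃ δ V, z₀ ∈ V ∧ PolylogKernelRegular b δ V := by
  have hr : (0 : ℝ) < r := Nat.cast_pos.mpr (NeZero.pos r)
  obtain ⟨κ, hκ, hκ0⟩ := ((eventually_all.mpr fun j =>
    eventually_norm_one_sub_mul_exp_ge (hz₀ j)).and self_mem_nhdsWithin).exists
  have hκ0 : 0 < κ := hκ0
  -- A tail sum has at most `r` terms, so strips of width `κ / r` keep it in the region controlled
  -- by `κ`.
  set δ := κ / r with hδ
  have hδ0 : 0 < δ := by positivity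
  have hrδ : r * δ = κ := by rw [hδ]; field_simp
  have hev : ∀ᶠ z in 𝓝 z₀, ∀ j, (∀ X : ℂ, -κ ≤ X.re → |X.im| ≤ κ →
      κ ≤ ‖1 - z j * Complex.exp (-X)‖) ∧ ‖z j‖ < ‖z₀ j‖ + 1 := by
    refine eventually_all.mpr fun j => ?_
    have hc : ContinuousAt (fun z : Fin r → ℂ => z j) z₀ :=
      (continuous_apply j).continuousAt
    exact (hc.eventually (hκ j)).and (hc.norm.eventually_lt_const (lt_add_one _))
  obtain ⟨V, hV, hVo, hzV⟩ := _root_.eventually_nhds_iff.mp hev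
  have hden : ∀ z ∈ V, ∀ x ∈ polyStrip (Fin r) δ, ∀ j,
      κ ≤ ‖1 - z j * Complex.exp (-tailSum x j)‖ := by
    intro z hz x hx j
    refine (hV z hz j).1 _ ?_ ?_
    · rw [← hrδ]; exact neg_le_tailSum_re hδ0 hx j
    · rw [← hrδ]; exact abs_tailSum_im_le hδ0 hx j
  refine ⟨δ, V, hzV, hδ0, hVo, fun z hz x hx j h0 => ?_,
    (∏ j, ((‖z₀ j‖ + 1) * Real.exp (r * δ)) ^ b j) * (κ⁻¹) ^ r, fun z hz x hx => ?_⟩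
  · have := hden z hz x hx j
    rw [h0, norm_zero] at this
    linarith
  · rw [polylogKernel, norm_prod]
    simp only [div_eq_mul_inv, norm_mul _ (_⁻¹), norm_inv]
    rw [Finset.prod_mul_distrib]
    have h1 : ∏ j, ‖1 - z j * Complex.exp (-tailSum x j)‖⁻¹ ≤ κ⁻¹ ^ r := by
      calc _ ≤ ∏ _j : Fin r, κ⁻¹ := Finset.prod_le_prod (fun _ _ => by positivity)
            fun j _ => inv_anti₀ hκ0 (hden z hz x hx j)
        _ = _ := by simp
    have h2 : ∏ j, (‖z j‖ * Real.exp (r * δ)) ^ b j ≤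
        ∏ j, ((‖z₀ j‖ + 1) * Real.exp (r * δ)) ^ b j := by
      gcongr with j
      exact (hV z hz j).2.le
    calc _ ≤ ((∏ j, (‖z j‖ * Real.exp (r * δ)) ^ b j) * Real.exp (-1 * ∑ i, (x i).re)) *
          κ⁻¹ ^ r := by
          refine mul_le_mul (norm_prod_exp_tailSum_le hδ0 hb z hx) h1 (by positivity)
            (by positivity)
      _ ≤ ((∏ j, ((‖z₀ j‖ + 1) * Real.exp (r * δ)) ^ b j) * Real.exp (-1 * ∑ i, (x i).re)) *
          κ⁻¹ ^ r := by gcongr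
      _ = _ := by ring

end

/-! ### Series expansion and continuation of the polylogarithm -/

/-- A product of absolutely convergent series, expanded. -/
theorem hasSum_prod_fin {n : ℕ} (f : Fin n → ℕ → ℂ) (hf : ∀ j, Summable fun k => ‖f j k‖) :
    (Summable fun m : Fin n → ℕ => ‖∏ j, f j (m j)‖) ∧
      HasSum (fun m : Fin n → ℕ => ∏ j, f j (m j)) (∏ j, ∑' k, f j k) := by
  induction n with
  | zero =>
    refine ⟨Summable.of_finite, ?_⟩
    simp [hasSum_unique]
  | succ n ih =>
    obtain ⟨h1, h2⟩ := ih (fun j => f j.succ) fun j => hf j.succ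
    let e := Fin.consEquiv fun _ : Fin (n + 1) => ℕ
    have he : ∀ p : ℕ × (Fin n → ℕ), ∏ j, f j (e p j) = f 0 p.1 * ∏ j, f (Fin.succ j) (p.2 j) := by
      intro p
      simp [e, Fin.prod_univ_succ]
    constructor
    · rw [← e.summable_iff]
      refine ((hf 0).mul_norm h1).congr fun p => ?_
      simp only [Function.comp, he]
    · rw [← e.hasSum_iff, Fin.prod_univ_succ]
      have hfun : (fun m : Fin (n + 1) → ℕ => ∏ j, f j (m j)) ∘ e =
          fun p => f 0 p.1 * ∏ j, f (Fin.succ j) (p.2 j) := funext he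
      rw [hfun]
      have hs := summable_mul_of_summable_norm (f := f 0)
        (g := fun m : Fin n → ℕ => ∏ j, f (Fin.succ j) (m j)) (hf 0) h1
      exact HasSum.mul (f := f 0) (g := fun m : Fin n → ℕ => ∏ j, f (Fin.succ j) (m j))
        (hf 0).of_norm.hasSum h2 hs

section

variable {r : ℕ}

/-- Exchanging the two sums turns tail sums of `x` into partial sums of `l`; this is where the
denominators `l_1 + ⋯ + l_j` come from. -/
theorem sum_mul_tailSum (l : Fin r → ℕ) (x : Fin r → ℂ) :
    ∑ j, (l j : ℂ) * tailSum x j = ∑ j, (((∑ i ∈ Finset.Iic j, l i : ℕ) : ℝ) : ℂ) * x j := by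
  simp only [tailSum, Finset.mul_sum]
  push_cast
  simp only [Finset.sum_mul]
  exact Finset.sum_comm' (by simp)

/-- A term of the expansion of `polylogKernel` into a multiple geometric series. -/
def polylogTerm (b : Fin r → ℕ) (z : Fin r → ℂ) (m : Fin r → ℕ) (x : Fin r → ℂ) : ℂ :=
  ∏ j, z j ^ (b j + m j) * Complex.exp (-((b j + m j : ℕ) * tailSum x j))

theorem polylogTerm_eq (b : Fin r → ℕ) (z : Fin r → ℂ) (m : Fin r → ℕ) (x : Fin r → ℂ) :
    polylogTerm b z m x = (∏ j, z j ^ (b j + m j)) *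
      Complex.exp (-∑ j, (((∑ i ∈ Finset.Iic j, (b i + m i) : ℕ) : ℝ) : ℂ) * x j) := by
  rw [polylogTerm, Finset.prod_mul_distrib, ← Complex.exp_sum, Finset.sum_neg_distrib,
    sum_mul_tailSum (fun j => b j + m j)]

theorem hasSum_polylogTerm (b : Fin r → ℕ) {z x : Fin r → ℂ}
    (h : ∀ j, ‖z j * Complex.exp (-tailSum x j)‖ < 1) :
    HasSum (fun m => polylogTerm b z m x) (polylogKernel b z x) := by
  have h1 := (hasSum_prod_fin (fun j k => z j ^ b j * Complex.exp (-(b j * tailSum x j)) *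
    (z j * Complex.exp (-tailSum x j)) ^ k) fun j => by
      simp only [norm_mul (z j ^ b j * _), norm_pow (z j * _)]
      exact (summable_geometric_of_lt_one (norm_nonneg _) (h j)).mul_left _).2
  have h2 : ∏ j, ∑' k : ℕ, (z j ^ b j * Complex.exp (-(b j * tailSum x j)) *
      (z j * Complex.exp (-tailSum x j)) ^ k) = polylogKernel b z x := by
    refine Finset.prod_congr rfl fun j _ => ?_
    rw [tsum_mul_left, tsum_geometric_of_norm_lt_one (h j), div_eq_mul_inv]
  have h3 : (fun m => polylogTerm b z m x) = fun m : Fin r → ℕ => ∏ j, (z j ^ b j *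
      Complex.exp (-(b j * tailSum x j)) * (z j * Complex.exp (-tailSum x j)) ^ m j) := by
    funext m
    refine Finset.prod_congr rfl fun j _ => ?_
    have : -(((b j + m j : ℕ) : ℂ) * tailSum x j) =
        -(b j * tailSum x j) + m j * (-tailSum x j) := by push_cast; ring
    rw [this, Complex.exp_add, Complex.exp_nat_mul, pow_add, mul_pow]
    ring
  rw [← h2, h3]
  exact h1

theorem tensor_const_mul {ι : Type*} [Fintype ι] (D : ι → Density) (a : ℂ) (K : (ι → ℂ) → ℂ) :
    tensor D (fun x => a * K x) = a * tensor D K := by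
  rw [tensor, tensor, ← integral_const_mul]
  congr 1
  funext τ
  simp only [tensorIntegrand]
  ring

theorem one_le_sum_Iic [NeZero r] {l : Fin r → ℕ} (hl : 1 ≤ l 0) (j : Fin r) :
    1 ≤ ∑ i ∈ Finset.Iic j, l i :=
  hl.trans (Finset.single_le_sum (fun _ _ => Nat.zero_le _) (by simp))

theorem isDecaying_polylogTerm [NeZero r] {δ : ℝ} (hδ : 0 < δ) {b : Fin r → ℕ} (hb : 1 ≤ b 0)
    (z : Fin r → ℂ) (m : Fin r → ℕ) : IsDecaying δ 1 (polylogTerm b z m) := by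
  refine ⟨Differentiable.differentiableOn ?_,
    ∏ j, (‖z j‖ * Real.exp (r * δ)) ^ (b j + m j), fun x hx => ?_⟩
  · have : polylogTerm b z m = _ := funext (polylogTerm_eq b z m)
    rw [this]
    fun_prop
  · rw [polylogTerm, norm_prod]
    exact norm_prod_exp_tailSum_le hδ (l := fun j => b j + m j)
      (hb.trans (Nat.le_add_right _ _)) z hx

/-- For `|z_j| < 1` the Mellin transform of the kernel is the defining series. -/
theorem mellin_polylogKernel_eq_series [NeZero r] {b : Fin r → ℕ} (hb : 1 ≤ b 0) {δ ε : ℝ}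
    (hε : 0 < ε) (hδ : ε < δ) {z : Fin r → ℂ} (hz : ∀ j, ‖z j‖ * Real.exp (r * δ) < 1)
    (u : Fin r → ℂ) : mellin ε (polylogKernel b z) u = polylogSeries b u z := by
  have hδ0 : 0 < δ := hε.trans hδ
  set D : Fin r → Density := fun i => mellinDensity ε (u i)
  have hadm : ∀ i, (D i).Admissible δ 1 := fun i => admissible_mellinDensity hε hδ one_pos _
  have hpos : ∀ m : Fin r → ℕ, ∀ j, 1 ≤ ∑ i ∈ Finset.Iic j, (b i + m i) := fun m j =>
    one_le_sum_Iic (l := fun j => b j + m j) (hb.trans (Nat.le_add_right _ _)) j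
  have hterm : ∀ m : Fin r → ℕ, tensor D (polylogTerm b z m) =
      ∏ j, z j ^ (b j + m j) / (((∑ i ∈ Finset.Iic j, (b i + m i) : ℕ) : ℂ) ^ u j) := by
    intro m
    have hm := mellin_exp hε u (a := fun j => ((∑ i ∈ Finset.Iic j, (b i + m i) : ℕ) : ℝ))
      fun j => by exact_mod_cast hpos m j
    have : polylogTerm b z m = _ := funext (polylogTerm_eq b z m)
    rw [this, tensor_const_mul]
    rw [mellin] at hm
    rw [hm, ← Finset.prod_mul_distrib]
    simp only [div_eq_mul_inv, Complex.ofReal_natCast]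
  set W := ∏ i, ∫ τ, (‖(D i).wt τ‖ * Real.exp (-1 * ((D i).pt τ).re)) with hW
  have hnorm : ∀ m : Fin r → ℕ, ∀ τ, ‖tensorIntegrand D (polylogTerm b z m) τ‖ ≤
      (∏ j, (‖z j‖ * Real.exp (r * δ)) ^ (b j + m j)) *
        ∏ i, (‖(D i).wt (τ i)‖ * Real.exp (-1 * ((D i).pt (τ i)).re)) := by
    intro m τ
    refine norm_tensorIntegrand_le (δ := δ) (fun i => (hadm i).mem) (fun x hx => ?_) τ
    rw [polylogTerm, norm_prod]
    exact norm_prod_exp_tailSum_le hδ0 (l := fun j => b j + m j)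
      (hb.trans (Nat.le_add_right _ _)) z hx
  have hint : Integrable fun τ : Fin r → ℝ =>
      ∏ i, (‖(D i).wt (τ i)‖ * Real.exp (-1 * ((D i).pt (τ i)).re)) :=
    Integrable.fintype_prod (μ := fun _ => volume) fun i => (hadm i).integrable
  -- Termwise integration is justified by a product of geometric series with ratios `‖z j‖ * e^{rδ}
  -- < 1`.
  have hsum : Summable fun m => ∫ τ, ‖tensorIntegrand D (polylogTerm b z m) τ‖ := by
    have h1 := (hasSum_prod_fin (fun j k => (((‖z j‖ * Real.exp (r * δ)) ^ (b j + k) : ℝ) : ℂ))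
      fun j => by
        refine ((summable_geometric_of_lt_one (by positivity) (hz j)).mul_left
          ((‖z j‖ * Real.exp (r * δ)) ^ b j)).congr fun k => ?_
        rw [Complex.norm_real, Real.norm_of_nonneg (by positivity), pow_add]).1
    refine Summable.of_nonneg_of_le (fun m => integral_nonneg fun τ => norm_nonneg _)
      (fun m => ?_) (h1.mul_right W)
    have h2 := integral_mono
      (integrable_tensorIntegrand hadm (isDecaying_polylogTerm hδ0 hb z m)).norm
      (hint.const_mul _) (hnorm m)
    refine h2.trans_eq ?_
    rw [integral_const_mul, hW, ← integral_fintype_prod_volume_eq_prod (𝕜 := ℝ)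
      (fun i τ => ‖(D i).wt τ‖ * Real.exp (-1 * ((D i).pt τ).re)), ← Complex.ofReal_prod,
      Complex.norm_real, Real.norm_of_nonneg (by positivity)]
  have hmain := hasSum_integral_of_summable_integral_norm
    (fun m => integrable_tensorIntegrand hadm (isDecaying_polylogTerm hδ0 hb z m)) hsum
  have hpt : ∀ τ, ∑' m, tensorIntegrand D (polylogTerm b z m) τ =
      tensorIntegrand D (polylogKernel b z) τ := by
    intro τ
    refine HasSum.tsum_eq ?_
    refine (hasSum_polylogTerm b fun j => ?_).mul_left _
    rw [norm_mul, Complex.norm_exp, Complex.neg_re]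
    refine lt_of_le_of_lt
        (mul_le_mul_of_nonneg_left (Real.exp_le_exp.mpr ?_) (norm_nonneg _)) (hz j)
    have := neg_le_tailSum_re hδ0 (x := fun i => (D i).pt (τ i))
      (mem_polyStrip.mpr fun i => (hadm i).mem _) j
    linarith
  simp only [hpt] at hmain
  rw [mellin, tensor, ← hmain.tsum_eq, polylogSeries]
  exact tsum_congr hterm

theorem IsDecaying.mono {ι : Type*} [Fintype ι] {δ δ' c : ℝ} {K : (ι → ℂ) → ℂ}
    (hK : IsDecaying δ c K) (h : δ' ≤ δ) : IsDecaying δ' c K := by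
  have hsub : polyStrip ι δ' ⊆ polyStrip ι δ := fun x hx => by
    rw [mem_polyStrip] at *
    exact fun i => strip_mono h (hx i)
  obtain ⟨C, hC⟩ := hK.bound
  exact ⟨hK.diff.mono hsub, C, fun x hx => hC x (hsub hx)⟩

theorem mem_polylogDomain {p : (Fin r → ℂ) × (Fin r → ℂ)} :
    p ∈ polylogDomain r ↔ ∀ j, p.2 j ∈ slitPlaneOne := Iff.rfl

theorem isOpen_polylogDomain : IsOpen (polylogDomain r) := by
  have : polylogDomain r = Prod.snd ⁻¹' (univ.pi fun _ : Fin r => slitPlaneOne) := by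
    ext p
    simp [mem_polylogDomain]
  rw [this]
  exact (isOpen_set_pi finite_univ fun _ _ => isOpen_slitPlaneOne).preimage continuous_snd

theorem mem_slitPlaneOne_of_norm_lt {z : ℂ} (hz : ‖z‖ < 1) : z ∈ slitPlaneOne := by
  rintro ⟨x, hx, rfl⟩
  rw [Complex.norm_real, Real.norm_eq_abs] at hz
  exact absurd ((le_abs_self x).trans_lt hz) (not_lt.mpr hx)

/-- The domain is star-shaped about 0: if `t z` were real and at least 1 with `0 < t ≤ 1`, so would
`z` be. -/
theorem isPreconnected_polylogDomain : IsPreconnected (polylogDomain r) := by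
  have h0 : (0 : (Fin r → ℂ) × (Fin r → ℂ)) ∈ polylogDomain r :=
    mem_polylogDomain.mpr fun j => mem_slitPlaneOne_of_norm_lt (by simp)
  refine (StarConvex.isPathConnected (a := 0) ?_ h0).isConnected.isPreconnected
  rw [starConvex_zero_iff]
  intro p hp t ht0 ht1
  rw [mem_polylogDomain] at *
  rintro j ⟨x, hx, hxj⟩
  have hx : 1 ≤ x := hx
  have hxj : (x : ℂ) = t * p.2 j := by simpa using hxj
  have ht : 0 < t := by
    refine lt_of_le_of_ne ht0 fun h => ?_
    rw [← h, Complex.ofReal_zero, zero_mul, Complex.ofReal_eq_zero] at hxj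
    linarith
  refine hp j ⟨x / t, ?_, ?_⟩
  · rw [mem_Ici, le_div_iff₀ ht]
    linarith
  · rw [Complex.ofReal_div, hxj]
    field_simp [Complex.ofReal_ne_zero.mpr ht.ne']

/-- The analytic continuation of the multiple polylogarithm exists, and is given by the continued
Mellin transform of `polylogKernel`. -/
theorem exists_isPolylogContinuation [NeZero r] {b : Fin r → ℕ} (hb : 1 ≤ b 0) :
    ∃ L, IsPolylogContinuation b L ∧ ∀ z : Fin r → ℂ, (∀ j, z j ∈ slitPlaneOne) →
      ∀ δ ε : ℝ, 0 < ε → ε < δ → IsDecaying δ 1 (polylogKernel b z) →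
        ∀ u, L (u, z) = mellin ε (polylogKernel b z) u := by
  classical
  -- The values off the slit plane are dummies that make `δ` and `V` total functions.
  have hex : ∀ z : Fin r → ℂ, ∃ δ V, (∀ j, z j ∈ slitPlaneOne) →
      z ∈ V ∧ PolylogKernelRegular b δ V := by
    intro z
    by_cases h : ∀ j, z j ∈ slitPlaneOne
    · obtain ⟨δ, V, hV⟩ := exists_polylogKernelRegular hb h
      exact ⟨δ, V, fun _ => hV⟩
    · exact ⟨0, ∅, fun h' => absurd h' h⟩
  choose δ V hδV using hex
  -- The larger of the two strips contains both contours, so the radii can be compared there. This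
  -- is what makes the pointwise choice of `δ z` give a locally analytic function.
  have hindep : ∀ z : Fin r → ℂ, (∀ j, z j ∈ slitPlaneOne) →
      ∀ δ' ε : ℝ, 0 < ε → ε < δ' → IsDecaying δ' 1 (polylogKernel b z) →
        ∀ u, mellin (δ z / 2) (polylogKernel b z) u = mellin ε (polylogKernel b z) u := by
    intro z hz δ' ε hε hδ' hK u
    obtain ⟨hzV, hreg⟩ := hδV z hz
    have hpos := hreg.pos
    rcases le_total δ' (δ z) with h | h
    · exact mellin_congr_radius (half_pos hpos) (half_lt_self hpos) hε (hδ'.trans_le h) one_pos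
        (hreg.isDecaying hzV) u
    · exact mellin_congr_radius (half_pos hpos) ((half_lt_self hpos).trans_le h) hε hδ' one_pos hK u
  refine ⟨fun p => mellin (δ p.2 / 2) (polylogKernel b p.2) p.1, ⟨?_, ?_⟩, hindep⟩
  · rintro ⟨u₀, z₀⟩ h₀
    obtain ⟨hzV, hreg⟩ := hδV z₀ h₀
    have hpos := hreg.pos
    obtain ⟨C, hC⟩ := hreg.bound
    have han := analyticOnNhd_mellin (ι := Fin r) hreg.isOpen (half_pos hpos) (half_lt_self hpos)
      one_pos (K := polylogKernel b) (fun y hy => hreg.differentiableOn hy)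
      (fun z hz => hreg.isDecaying hz)
      (fun z hz => ⟨C, (hreg.isOpen.eventually_mem hz).mono fun z hz => hC z hz⟩)
    refine (han (u₀, z₀) ⟨mem_univ _, hzV⟩).congr ?_
    filter_upwards [isOpen_polylogDomain.mem_nhds h₀,
      continuous_snd.continuousAt.eventually (hreg.isOpen.eventually_mem hzV)] with p hp hpV
    exact (hindep p.2 hp (δ z₀) (δ z₀ / 2) (half_pos hpos) (half_lt_self hpos)
      (hreg.isDecaying hpV) p.1).symm
  · intro u z hz
    have hz' : ∀ j, z j ∈ slitPlaneOne := fun j => mem_slitPlaneOne_of_norm_lt (hz j)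
    obtain ⟨hzV, hreg⟩ := hδV z hz'
    -- The strip is narrowed so that `‖z j‖ e^{rδ'}` remains below 1 and the series converges along
    -- the whole contour.
    have hev : ∀ᶠ δ' : ℝ in 𝓝[>] 0, (∀ j, ‖z j‖ * Real.exp (r * δ') < 1) ∧ δ' < δ z := by
      refine (eventually_all.mpr fun j => ?_).and (nhdsWithin_le_nhds (gt_mem_nhds hreg.pos))
      have hc : ContinuousAt (fun δ' : ℝ => ‖z j‖ * Real.exp (r * δ')) 0 := by fun_prop
      exact nhdsWithin_le_nhds (hc.eventually_lt_const (by simpa using hz j))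
    obtain ⟨δ', ⟨h1, h2⟩, h3⟩ := (hev.and self_mem_nhdsWithin).exists
    have h3 : 0 < δ' := h3
    simp only
    rw [hindep z hz' δ' (δ' / 2) (half_pos h3) (half_lt_self h3)
      ((hreg.isDecaying hzV).mono h2.le) u]
    exact mellin_polylogKernel_eq_series hb (half_pos h3) (half_lt_self h3) h1 u

/-- `polylog` is the analytic continuation of its defining series. -/
theorem isPolylogContinuation_polylog [NeZero r] {b : Fin r → ℕ} (hb : 1 ≤ b 0) :
    IsPolylogContinuation b fun p => polylog b p.1 p.2 := by
  obtain ⟨L, hL, -⟩ := exists_isPolylogContinuation hb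
  have h : ∃ L : (Fin r → ℂ) × (Fin r → ℂ) → ℂ, IsPolylogContinuation b L := ⟨L, hL⟩
  have : (fun p : (Fin r → ℂ) × (Fin r → ℂ) => polylog b p.1 p.2) = h.choose := by
    funext p
    rw [polylog, dif_pos h]
  rw [this]
  exact h.choose_spec

/-- Two continuations agree near the origin, hence on the connected domain. -/
theorem IsPolylogContinuation.eqOn {b : Fin r → ℕ} {L L' : (Fin r → ℂ) × (Fin r → ℂ) → ℂ}
    (hL : IsPolylogContinuation b L) (hL' : IsPolylogContinuation b L') :
    EqOn L L' (polylogDomain r) := by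
  have h0 : (0 : (Fin r → ℂ) × (Fin r → ℂ)) ∈ polylogDomain r :=
    mem_polylogDomain.mpr fun j => mem_slitPlaneOne_of_norm_lt (by simp)
  refine hL.1.eqOn_of_preconnected_of_eventuallyEq hL'.1 isPreconnected_polylogDomain h0 ?_
  have hev : ∀ᶠ p : (Fin r → ℂ) × (Fin r → ℂ) in 𝓝 0, ∀ j, ‖p.2 j‖ < 1 := by
    refine eventually_all.mpr fun j => ?_
    have hc : Continuous fun p : (Fin r → ℂ) × (Fin r → ℂ) => ‖p.2 j‖ :=
      ((continuous_apply j).comp continuous_snd).norm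
    exact hc.continuousAt.eventually_lt_const (by simp)
  filter_upwards [hev] with p hp
  rw [hL.2 p.1 p.2 hp, hL'.2 p.1 p.2 hp]

/-- The multiple polylogarithm as the continued Mellin transform of its kernel. -/
theorem polylog_eq_mellin [NeZero r] {b : Fin r → ℕ} (hb : 1 ≤ b 0) {δ ε : ℝ} (hε : 0 < ε)
    (hδ : ε < δ) {z : Fin r → ℂ} (hz : ∀ j, z j ∈ slitPlaneOne)
    (hK : IsDecaying δ 1 (polylogKernel b z)) (u : Fin r → ℂ) :
    polylog b u z = mellin ε (polylogKernel b z) u := by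
  obtain ⟨L, hL, h⟩ := exists_isPolylogContinuation hb
  rw [← h z hz δ ε hε hδ hK u]
  exact (isPolylogContinuation_polylog hb).eqOn hL (mem_polylogDomain.mpr hz : (u, z) ∈ _)

end

/-! ### Decay of the kernel of η -/

/-- Take real parts: cosines are at least `199/200` and both moduli at least `9/10`. So the `1` is
less than the `119/200` of the sum of moduli that is given away. -/
theorem le_norm_exp_add_exp_sub_one {T X : ℂ} (hT : -(1 / 10) ≤ T.re) (hT' : |T.im| ≤ 1 / 10)
    (hX : -(1 / 10) ≤ X.re) (hX' : |X.im| ≤ 1 / 10) :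
    2 / 5 * (Real.exp T.re + Real.exp X.re) ≤ ‖Complex.exp T + Complex.exp X - 1‖ := by
  have hcos : ∀ y : ℝ, |y| ≤ 1 / 10 → 199 / 200 ≤ Real.cos y := by
    intro y hy
    have h1 := Real.one_sub_sq_div_two_le_cos (x := y)
    have h2 : y ^ 2 ≤ (1 / 10) ^ 2 := sq_le_sq' (abs_le.mp hy).1 (abs_le.mp hy).2
    linarith
  have h1 := Real.add_one_le_exp T.re
  have h2 := Real.add_one_le_exp X.re
  have h3 := mul_le_mul_of_nonneg_left (hcos _ hT') (Real.exp_pos T.re).le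
  have h4 := mul_le_mul_of_nonneg_left (hcos _ hX') (Real.exp_pos X.re).le
  refine le_trans ?_ (Complex.re_le_norm _)
  rw [Complex.sub_re, Complex.add_re, Complex.exp_re, Complex.exp_re, Complex.one_re]
  linarith

section

variable {α β : ℝ} {a b : ℕ}

theorem self_mul_inv_pow_le (hα : 0 < α) (hα' : α⁻¹ ≤ 2) (a : ℕ) : α * α⁻¹ ^ a ≤ 2 ^ a * α := by
  rw [mul_comm]
  gcongr

theorem self_mul_inv_pow_le_of_one_le (hα : 0 < α) (hα' : α⁻¹ ≤ 2) (ha : 1 ≤ a) :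
    α * α⁻¹ ^ a ≤ 2 ^ a := by
  obtain ⟨k, rfl⟩ := Nat.exists_eq_add_of_le' ha
  rw [pow_succ', ← mul_assoc, mul_inv_cancel₀ hα.ne', one_mul]
  calc α⁻¹ ^ k ≤ 2 ^ k := by gcongr
    _ ≤ 2 ^ (k + 1) := by gcongr <;> simp

/-- The size of a factor of the kernel, in terms of `α = |e^T|` and `β = |e^X|`. -/
def factorSize (a b : ℕ) (α β : ℝ) : ℝ := α * α⁻¹ ^ a * (β * β⁻¹ ^ b) / (α + β)

/-- If `a = 0` then `b ≥ 1`, and the numerator is at most a constant times `α`; if `a ≥ 1` it is at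
most a constant times `β`. Either is absorbed by `α + β`. -/
theorem factorSize_le (hα : 0 < α) (hα' : α⁻¹ ≤ 2) (hβ : 0 < β) (hβ' : β⁻¹ ≤ 2)
    (hab : 1 ≤ a + b) : factorSize a b α β ≤ 2 ^ (a + b) := by
  rw [factorSize, div_le_iff₀ (by positivity), pow_add]
  rcases Nat.eq_zero_or_pos a with ha | ha
  · have h1 := self_mul_inv_pow_le hα hα' a
    have h2 := self_mul_inv_pow_le_of_one_le hβ hβ' (a := b) (by omega)
    calc _ ≤ 2 ^ a * α * 2 ^ b := mul_le_mul h1 h2 (by positivity) (by positivity)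
      _ = 2 ^ a * 2 ^ b * α := by ring
      _ ≤ _ := by gcongr; linarith
  · have h1 := self_mul_inv_pow_le hβ hβ' b
    have h2 := self_mul_inv_pow_le_of_one_le hα hα' ha
    calc _ ≤ 2 ^ a * (2 ^ b * β) := mul_le_mul h2 h1 (by positivity) (by positivity)
      _ = 2 ^ a * 2 ^ b * β := by ring
      _ ≤ _ := by gcongr; linarith

theorem factorSize_le_div (hα : 0 < α) (hα' : α⁻¹ ≤ 2) (hβ : 0 < β) (hβ' : β⁻¹ ≤ 2)
    (ha : 1 ≤ a) (hb : 1 ≤ b) : factorSize a b α β ≤ 2 ^ (a + b) / (α + β) := by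
  rw [factorSize, pow_add]
  gcongr
  · exact self_mul_inv_pow_le_of_one_le hα hα' ha
  · exact self_mul_inv_pow_le_of_one_le hβ hβ' hb

theorem factorSize_le_mul_div (hα : 0 < α) (hα' : α⁻¹ ≤ 2) (hβ : 0 < β) (hβ' : β⁻¹ ≤ 2)
    (hb : 1 ≤ b) : factorSize a b α β ≤ 2 ^ (a + b) * (α / (α + β)) := by
  rw [factorSize, pow_add, ← mul_div_assoc]
  refine div_le_div_of_nonneg_right ?_ (by positivity)
  calc _ ≤ 2 ^ a * α * 2 ^ b := mul_le_mul (self_mul_inv_pow_le hα hα' a)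
        (self_mul_inv_pow_le_of_one_le hβ hβ' hb) (by positivity) (by positivity)
    _ = 2 ^ a * 2 ^ b * α := by ring

/-- If `q ≤ 2p` the right side is at least 1; otherwise `α / q² ≤ 2p² / q²` suffices. The weaker
rate `1/q` is accepted so that the loss in `p` is only of first order. -/
theorem div_add_le_two_mul_div {p q : ℝ} (hα : 0 < α) (hp : 0 < p) (hq : 0 < q)
    (h : α ≤ 2 * p ^ 2) : α / (α + q ^ 2) ≤ 2 * p / q := by
  rw [div_le_div_iff₀ (by positivity) hq]
  rcases le_total q (2 * p) with h1 | h1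
  · nlinarith [mul_le_mul_of_nonneg_left h1 hα.le, mul_pos hp (pow_pos hq 2)]
  · have h2 : α * q ≤ 2 * p ^ 2 * q := by gcongr
    nlinarith [mul_pos hp hq, mul_pos hp hα]

end

section

variable {r : ℕ}

/-- The kernel of the contour integral, as a function of all the variables `t` and `x`. -/
def etaKernel (σ : Equiv.Perm (Fin r)) (a b : Fin r → ℕ) (y : Fin r ⊕ Fin r → ℂ) : ℂ :=
  ∏ j, Complex.exp ((1 - (a (σ j) : ℂ)) * tailSum (fun i => y (Sum.inl i)) (σ j)) *
      Complex.exp ((1 - (b j : ℂ)) * tailSum (fun i => y (Sum.inr i)) j) /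
    (Complex.exp (tailSum (fun i => y (Sum.inl i)) (σ j)) +
      Complex.exp (tailSum (fun i => y (Sum.inr i)) j) - 1)

theorem norm_exp_one_sub_mul (a : ℕ) (T : ℂ) :
    ‖Complex.exp ((1 - (a : ℂ)) * T)‖ = Real.exp T.re * (Real.exp T.re)⁻¹ ^ a := by
  have : ((1 - (a : ℂ)) * T).re = T.re + a * (-T.re) := by
    have : (1 - (a : ℂ)) * T = T - ((a : ℝ) : ℂ) * T := by push_cast; ring
    rw [this, Complex.sub_re, Complex.re_ofReal_mul]
    ring
  rw [Complex.norm_exp, this, Real.exp_add, Real.exp_nat_mul, Real.exp_neg]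

/-- Each omitted variable has real part at least `-δ`, so no tail sum exceeds the full sum by more
than `rδ`. -/
theorem re_tailSum_le_add {δ : ℝ} [NeZero r] (hδ : 0 < δ) {x : Fin r → ℂ}
    (hx : x ∈ polyStrip (Fin r) δ) (j : Fin r) :
    (tailSum x j).re ≤ (tailSum x 0).re + r * δ := by
  rw [mem_polyStrip] at hx
  rw [tailSum_zero, tailSum_re, Complex.re_sum,
    ← Finset.sum_add_sum_compl (Finset.Ici j) fun i => (x i).re]
  have h1 : ((Finset.Ici j)ᶜ.card : ℝ) ≤ r := by
    exact_mod_cast (Finset.card_le_univ _).trans_eq (Fintype.card_fin r)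
  have h2 := Finset.card_nsmul_le_sum (Finset.Ici j)ᶜ (fun i => (x i).re) (-δ)
    fun i _ => (hx i).1.le
  rw [nsmul_eq_mul] at h2
  nlinarith

theorem isDecaying_etaKernel [NeZero r] {σ : Equiv.Perm (Fin r)} {a b : Fin r → ℕ} (ha : 1 ≤ a 0)
    (hb : 1 ≤ b 0) (hb' : 1 ≤ b (σ.symm 0)) (hab : ∀ j, 1 ≤ a (σ j) + b j) :
    IsDecaying (1 / (10 * r)) (1 / 2) (etaKernel σ a b) := by
  have hr : (0 : ℝ) < r := Nat.cast_pos.mpr (NeZero.pos r)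
  -- All tail sums then have real part at least `-1/10` and imaginary part at most `1/10` in
  -- absolute value.
  set δ : ℝ := 1 / (10 * r) with hδ
  have hδ0 : 0 < δ := by positivity
  have hrδ : r * δ = 1 / 10 := by rw [hδ]; field_simp
  have hl : ∀ y ∈ polyStrip (Fin r ⊕ Fin r) δ, (fun i => y (Sum.inl i)) ∈ polyStrip (Fin r) δ := by
    intro y hy
    rw [mem_polyStrip] at *
    exact fun i => hy _
  have hr' : ∀ y ∈ polyStrip (Fin r ⊕ Fin r) δ, (fun i => y (Sum.inr i)) ∈ polyStrip (Fin r) δ := by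
    intro y hy
    rw [mem_polyStrip] at *
    exact fun i => hy _
  have hre : ∀ x ∈ polyStrip (Fin r) δ, ∀ j, -(1 / 10) ≤ (tailSum x j).re :=
    fun x hx j => hrδ ▸ neg_le_tailSum_re hδ0 hx j
  have him : ∀ x ∈ polyStrip (Fin r) δ, ∀ j, |(tailSum x j).im| ≤ 1 / 10 :=
    fun x hx j => hrδ ▸ abs_tailSum_im_le hδ0 hx j
  have hden : ∀ y ∈ polyStrip (Fin r ⊕ Fin r) δ, ∀ j,
      2 / 5 * (Real.exp (tailSum (fun i => y (Sum.inl i)) (σ j)).re +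
        Real.exp (tailSum (fun i => y (Sum.inr i)) j).re) ≤
      ‖Complex.exp (tailSum (fun i => y (Sum.inl i)) (σ j)) +
        Complex.exp (tailSum (fun i => y (Sum.inr i)) j) - 1‖ := fun y hy j =>
    le_norm_exp_add_exp_sub_one (hre _ (hl y hy) _) (him _ (hl y hy) _) (hre _ (hr' y hy) _)
      (him _ (hr' y hy) _)
  constructor
  · refine differentiableOn_prod fun j => ?_
    have h1 : Differentiable ℂ fun y : Fin r ⊕ Fin r → ℂ =>
        tailSum (fun i => y (Sum.inl i)) (σ j) :=
      (differentiable_tailSum (σ j)).comp (by fun_prop)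
    have h2 : Differentiable ℂ fun y : Fin r ⊕ Fin r → ℂ => tailSum (fun i => y (Sum.inr i)) j :=
      (differentiable_tailSum j).comp (by fun_prop)
    simp only [div_eq_mul_inv]
    refine DifferentiableOn.mul (Differentiable.differentiableOn (by fun_prop))
      (DifferentiableOn.inv (Differentiable.differentiableOn (by fun_prop)) fun y hy h0 => ?_)
    have := hden y hy j
    rw [h0, norm_zero] at this
    have h3 := Real.exp_pos (tailSum (fun i => y (Sum.inl i)) (σ j)).re
    have h4 := Real.exp_pos (tailSum (fun i => y (Sum.inr i)) j).re
    linarith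
  -- `5 / 2` inverts the denominator bound, the powers of 2 come from the factor sizes, and the last
  -- 2 from `2 * p / q`.
  · refine ⟨(∏ j, 5 / 2 * 2 ^ (a (σ j) + b j)) * 2, fun y hy => ?_⟩
    set T : Fin r → ℝ := fun j => (tailSum (fun i => y (Sum.inl i)) j).re with hT
    set X : Fin r → ℝ := fun j => (tailSum (fun i => y (Sum.inr i)) j).re with hX
    have hinv : ∀ s : ℝ, -(1 / 10) ≤ s → (Real.exp s)⁻¹ ≤ 2 := by
      intro s hs
      rw [inv_le_comm₀ (Real.exp_pos _) two_pos]
      have := Real.add_one_le_exp s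
      linarith
    have hTi : ∀ j, (Real.exp (T j))⁻¹ ≤ 2 := fun j => hinv _ (hre _ (hl y hy) j)
    have hXi : ∀ j, (Real.exp (X j))⁻¹ ≤ 2 := fun j => hinv _ (hre _ (hr' y hy) j)
    have hT0 : ∀ j, Real.exp (T j) ≤ 2 * Real.exp (T 0 / 2) ^ 2 := by
      intro j
      have h1 : T j ≤ T 0 + 1 / 10 := hrδ ▸ re_tailSum_le_add hδ0 (hl y hy) j
      have h2 : Real.exp (T 0 / 2) ^ 2 = Real.exp (T 0) := by
        rw [← Real.exp_nat_mul]; congr 1; push_cast; ring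
      have h3 : Real.exp (1 / 10) ≤ 2 := by
        have h4 := Real.add_one_le_exp (-(1 / 10 : ℝ))
        rw [Real.exp_neg] at h4
        have h5 := Real.exp_pos (1 / 10 : ℝ)
        have h6 : Real.exp (1 / 10) * (Real.exp (1 / 10))⁻¹ = 1 := mul_inv_cancel₀ h5.ne'
        nlinarith
      calc Real.exp (T j) ≤ Real.exp (T 0 + 1 / 10) := Real.exp_le_exp.mpr h1
        _ = Real.exp (1 / 10) * Real.exp (T 0) := by rw [Real.exp_add, mul_comm]
        _ ≤ _ := by rw [h2]; gcongr
    set p := Real.exp (T 0 / 2) with hp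
    set q := Real.exp (X 0 / 2) with hq
    have hp0 : 0 < p := Real.exp_pos _
    have hq0 : 0 < q := Real.exp_pos _
    have hpT : Real.exp (T 0) = p ^ 2 := by
      rw [hp, ← Real.exp_nat_mul]; congr 1; push_cast; ring
    have hqX : Real.exp (X 0) = q ^ 2 := by
      rw [hq, ← Real.exp_nat_mul]; congr 1; push_cast; ring
    -- With `p² = e^{T 0}` and `q² = e^{X 0}`, the gains at `σ.symm 0` and at `0` multiply to `p⁻² ·
    -- 2p/q = 2/(pq)`. If the two indices coincide, the single factor `1/(p² + q²)` gives the same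
    -- by the inequality of means.
    have hfac : ∀ j, factorSize (a (σ j)) (b j) (Real.exp (T (σ j))) (Real.exp (X j)) ≤
        2 ^ (a (σ j) + b j) *
          ((if j = σ.symm 0 then (p ^ 2)⁻¹ else 1) * if j = 0 then 2 * p / q else 1) := by
      intro j
      by_cases hk : j = σ.symm 0
      · have hσ : σ j = 0 := by rw [hk, Equiv.apply_symm_apply]
        have h1 := factorSize_le_div (a := a (σ j)) (b := b j) (Real.exp_pos (T (σ j))) (hTi _)
          (Real.exp_pos (X j)) (hXi _) (by rw [hσ]; exact ha) (by rw [hk]; exact hb')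
        refine h1.trans ?_
        rw [if_pos hk, div_eq_mul_inv]
        gcongr
        rw [hσ, hpT]
        split_ifs with h0
        · rw [h0, hqX, inv_eq_one_div, inv_eq_one_div, div_mul_div_comm,
            div_le_div_iff₀ (by positivity) (by positivity)]
          nlinarith [mul_pos hp0 hq0, mul_pos (pow_pos hp0 2) hp0, mul_pos (pow_pos hq0 2) hp0,
            sq_nonneg (p - q)]
        · rw [mul_one]
          gcongr
          have := Real.exp_pos (X j)
          linarith
      · rw [if_neg hk, one_mul]
        split_ifs with h0
        · have h1 := factorSize_le_mul_div (a := a (σ j)) (b := b j) (Real.exp_pos (T (σ j)))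
            (hTi _) (Real.exp_pos (X j)) (hXi _) (by rw [h0]; exact hb)
          refine h1.trans (mul_le_mul_of_nonneg_left ?_ (by positivity))
          rw [h0, hqX]
          exact div_add_le_two_mul_div (Real.exp_pos _) hp0 hq0 (hT0 _)
        · rw [mul_one]
          exact factorSize_le (Real.exp_pos _) (hTi _) (Real.exp_pos _) (hXi _) (hab j)
    have hsum : ∑ i, (y i).re = T 0 + X 0 := by
      simp only [hT, hX, tailSum_zero, Complex.re_sum, Fintype.sum_sum_type]
    have hexp : Real.exp (-(1 / 2) * ∑ i, (y i).re) = p⁻¹ * q⁻¹ := by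
      rw [hsum, hp, hq, ← Real.exp_neg, ← Real.exp_neg, ← Real.exp_add]
      congr 1
      ring
    rw [etaKernel, norm_prod]
    calc _ ≤ ∏ j, (5 / 2 * 2 ^ (a (σ j) + b j) *
          ((if j = σ.symm 0 then (p ^ 2)⁻¹ else 1) * if j = 0 then 2 * p / q else 1)) := by
          refine Finset.prod_le_prod (fun _ _ => norm_nonneg _) fun j _ => ?_
          rw [norm_div, norm_mul, norm_exp_one_sub_mul, norm_exp_one_sub_mul,
            mul_assoc (5 / 2 : ℝ)]
          refine le_trans ?_ (mul_le_mul_of_nonneg_left (hfac j) (by norm_num))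
          rw [factorSize]
          refine (div_le_div_of_nonneg_left (by positivity) (by positivity)
            (hden y hy j)).trans_eq ?_
          simp only [hT, hX]
          field_simp
      _ = _ := by
          simp only [Finset.prod_mul_distrib, Finset.prod_ite_eq', Finset.mem_univ, if_true]
          rw [hexp]
          field_simp

end

/-! ### Integrals over a sum of index types -/

section

theorem sumPiEquivProdPi_symm_eq_elim {ι κ : Type*} (p : (ι → ℝ) × (κ → ℝ)) :
    (MeasurableEquiv.sumPiEquivProdPi fun _ : ι ⊕ κ => ℝ).symm p = Sum.elim p.1 p.2 := by
  funext i
  cases i <;> rfl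

theorem sumPiEquivProdPi_symm_preimage_pi {ι κ : Type*} (S : Set ℝ) :
    (MeasurableEquiv.sumPiEquivProdPi fun _ : ι ⊕ κ => ℝ).symm ⁻¹' (univ.pi fun _ => S) =
      (univ.pi fun _ => S) ×ˢ (univ.pi fun _ => S) := by
  ext p
  rw [mem_preimage, sumPiEquivProdPi_symm_eq_elim]
  simp

variable {ι κ : Type*} [Fintype ι] [Fintype κ]

theorem integral_sum_pi (f : (ι ⊕ κ → ℝ) → ℂ) :
    ∫ y, f y = ∫ p : (ι → ℝ) × (κ → ℝ), f (Sum.elim p.1 p.2) := by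
  rw [← (volume_measurePreserving_sumPiEquivProdPi_symm fun _ : ι ⊕ κ => ℝ).integral_comp']
  simp only [sumPiEquivProdPi_symm_eq_elim]

theorem integrable_comp_sum_elim {f : (ι ⊕ κ → ℝ) → ℂ} (hf : Integrable f) :
    Integrable fun p : (ι → ℝ) × (κ → ℝ) => f (Sum.elim p.1 p.2) := by
  have h := ((volume_measurePreserving_sumPiEquivProdPi_symm
    fun _ : ι ⊕ κ => ℝ).integrable_comp_emb (MeasurableEquiv.measurableEmbedding _)).mpr hf
  refine h.congr (ae_of_all _ fun p => ?_)
  simp only [Function.comp_apply, sumPiEquivProdPi_symm_eq_elim]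

theorem setIntegral_sum_pi (f : (ι ⊕ κ → ℝ) → ℂ) (S : Set ℝ) :
    ∫ y in univ.pi fun _ => S, f y =
      ∫ p in (univ.pi fun _ : ι => S) ×ˢ (univ.pi fun _ : κ => S), f (Sum.elim p.1 p.2) := by
  rw [← (volume_measurePreserving_sumPiEquivProdPi_symm
    fun _ : ι ⊕ κ => ℝ).setIntegral_preimage_emb (MeasurableEquiv.measurableEmbedding _),
    sumPiEquivProdPi_symm_preimage_pi]
  simp only [sumPiEquivProdPi_symm_eq_elim]

theorem integrableOn_comp_sum_elim {f : (ι ⊕ κ → ℝ) → ℂ} {S : Set ℝ}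
    (hf : IntegrableOn f (univ.pi fun _ => S)) :
    IntegrableOn (fun p : (ι → ℝ) × (κ → ℝ) => f (Sum.elim p.1 p.2))
      ((univ.pi fun _ => S) ×ˢ (univ.pi fun _ => S)) := by
  have h := ((volume_measurePreserving_sumPiEquivProdPi_symm
    fun _ : ι ⊕ κ => ℝ).integrableOn_comp_preimage (MeasurableEquiv.measurableEmbedding _)).mpr hf
  rw [sumPiEquivProdPi_symm_preimage_pi] at h
  refine IntegrableOn.congr_fun_ae h (ae_of_all _ fun p => ?_)
  simp only [Function.comp_apply, sumPiEquivProdPi_symm_eq_elim]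

end

/-! ### η as a Mellin transform of its kernel -/

section

variable {r : ℕ} (σ : Equiv.Perm (Fin r)) (a b : Fin r → ℕ)

theorem tensorIntegrand_hankelDensity_etaKernel (ε : ℝ) (u s : Fin r → ℂ)
    (p : (Fin r → ℝ) × (Fin r → ℝ)) :
    tensorIntegrand (fun i => hankelDensity ε (Sum.elim s u i)) (etaKernel σ a b)
      (Sum.elim p.1 p.2) = contourIntegrand ε σ a b u s p := by
  simp only [tensorIntegrand, hankelDensity, etaKernel, contourIntegrand, Fintype.prod_sum_type,
    Sum.elim_inl, Sum.elim_inr, Finset.prod_mul_distrib]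
  ring

theorem contourIntegral_eq_tensor (ε : ℝ) (u s : Fin r → ℂ) :
    contourIntegral ε σ a b u s =
      tensor (fun i => hankelDensity ε (Sum.elim s u i)) (etaKernel σ a b) := by
  rw [tensor, integral_sum_pi]
  simp only [tensorIntegrand_hankelDensity_etaKernel, contourIntegral]

/-- With `z = 1 - e^T` one has `1 - z e^{-X} = e^{-X}(e^T + e^X - 1)`, and `z^b` cancels the
normalising power in η, legitimately because `z ≠ 0`. -/
theorem etaKernel_sum_elim (t x : Fin r → ℂ)
    (hz : ∀ j, 1 - Complex.exp (tailSum t (σ j)) ≠ 0) :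
    etaKernel σ a b (Sum.elim t x) =
      (∏ j, Complex.exp ((1 - (a j : ℂ)) * tailSum t j)) *
        ((∏ j, (1 - Complex.exp (tailSum t (σ j))) ^ b j)⁻¹ *
          polylogKernel b (fun j => 1 - Complex.exp (tailSum t (σ j))) x) := by
  rw [← Equiv.prod_comp σ fun j => Complex.exp ((1 - (a j : ℂ)) * tailSum t j)]
  simp only [etaKernel, polylogKernel, Sum.elim_inl, Sum.elim_inr, ← Finset.prod_inv_distrib,
    ← Finset.prod_mul_distrib]
  refine Finset.prod_congr rfl fun j _ => ?_
  have h1 : 1 - (1 - Complex.exp (tailSum t (σ j))) * Complex.exp (-tailSum x j) =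
      Complex.exp (-tailSum x j) *
        (Complex.exp (tailSum t (σ j)) + Complex.exp (tailSum x j) - 1) := by
    have : Complex.exp (-tailSum x j) * Complex.exp (tailSum x j) = 1 := by
      rw [← Complex.exp_add, neg_add_cancel, Complex.exp_zero]
    linear_combination -this
  have h2 : Complex.exp ((1 - (b j : ℂ)) * tailSum x j) =
      Complex.exp (-(b j * tailSum x j)) * (Complex.exp (-tailSum x j))⁻¹ := by
    rw [← Complex.exp_neg, ← Complex.exp_add]
    congr 1
    ring
  rw [h1, h2, mul_div_assoc ((1 - Complex.exp _) ^ b j), inv_mul_cancel_left₀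
    (pow_ne_zero _ (hz j)), div_mul_eq_div_div, div_eq_mul_inv (Complex.exp (-(_ * _))),
    mul_div_assoc]

variable {σ a b}

theorem tailSum_ofReal (t : Fin r → ℝ) (j : Fin r) :
    tailSum (fun i => (t i : ℂ)) j = ((∑ i ∈ Finset.Ici j, t i : ℝ) : ℂ) := by
  simp [tailSum]

/-- The points at which the polylogarithm is evaluated are negative real numbers. -/
theorem exists_one_sub_exp_tailSum_eq {t : Fin r → ℝ} (ht : ∀ i, 0 < t i) (j : Fin r) :
    ∃ y : ℝ, y < 0 ∧ 1 - Complex.exp (tailSum (fun i => (t i : ℂ)) j) = y := by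
  refine ⟨1 - Real.exp (∑ i ∈ Finset.Ici j, t i), ?_, ?_⟩
  · rw [sub_neg, Real.one_lt_exp_iff]
    exact Finset.sum_pos (fun i _ => ht i) ⟨j, Finset.mem_Ici.mpr le_rfl⟩
  · rw [tailSum_ofReal]
    push_cast
    rfl

/-- At negative real `z` the polylogarithm is a continued Mellin transform, which for `Re u > 0` is
a genuine integral over `x`. -/
theorem etaIntegrand_eq [NeZero r] (hb : 1 ≤ b 0) {u : Fin r → ℂ} (hu : ∀ j, 0 < (u j).re)
    (s : Fin r → ℂ) {t : Fin r → ℝ} (ht : ∀ i, 0 < t i) :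
    etaIntegrand σ a b u s t = (∏ j, (Complex.Gamma (u j))⁻¹) *
      ∫ x in univ.pi fun _ : Fin r => Ioi (0 : ℝ),
        (∏ i, ((Sum.elim t x i : ℝ) : ℂ) ^ (Sum.elim s u i - 1)) *
          etaKernel σ a b fun i => ((Sum.elim t x i : ℝ) : ℂ) := by
  set z : Fin r → ℂ := fun j => 1 - Complex.exp (tailSum (fun i => (t i : ℂ)) (σ j)) with hz
  have hz0 : ∀ j, z j ≠ 0 := fun j => by
    obtain ⟨y, hy, h⟩ := exists_one_sub_exp_tailSum_eq ht (σ j)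
    simp only [hz, h]
    exact_mod_cast hy.ne
  have hzs : ∀ j, z j ∈ slitPlaneOne := by
    rintro j ⟨y', hy', h'⟩
    obtain ⟨y, hy, h⟩ := exists_one_sub_exp_tailSum_eq ht (σ j)
    have h2 : y' = y := by exact_mod_cast h'.trans h
    have h3 : (1 : ℝ) ≤ y' := hy'
    linarith
  obtain ⟨δ, V, hV, hreg⟩ := exists_polylogKernelRegular hb hzs
  have hδ := hreg.pos
  rw [etaIntegrand, polylog_eq_mellin hb (half_pos hδ) (half_lt_self hδ) hzs (hreg.isDecaying hV),
    mellin_of_re_pos _ _ hu]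
  have hpt : ∀ x : Fin r → ℝ, (∏ i, ((Sum.elim t x i : ℝ) : ℂ) ^ (Sum.elim s u i - 1)) *
      etaKernel σ a b (fun i => ((Sum.elim t x i : ℝ) : ℂ)) =
      ((∏ j, (t j : ℂ) ^ (s j - 1)) * (∏ j, Complex.exp ((1 - (a j : ℂ)) *
        tailSum (fun i => (t i : ℂ)) j)) * (∏ j, z j ^ b j)⁻¹) *
      ((∏ i, (x i : ℂ) ^ (u i - 1)) * polylogKernel b z fun i => (x i : ℂ)) := by
    intro x
    have h : (fun i => ((Sum.elim t x i : ℝ) : ℂ)) =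
        Sum.elim (fun i => (t i : ℂ)) fun i => (x i : ℂ) := by
      funext i
      cases i <;> rfl
    rw [h, etaKernel_sum_elim σ a b _ _ hz0, Fintype.prod_sum_type]
    simp only [Sum.elim_inl, Sum.elim_inr]
    ring
  simp only [hpt]
  rw [integral_const_mul, Finset.prod_mul_distrib]
  ring

theorem re_sum_elim_pos {u s : Fin r → ℂ} (hu : ∀ j, 0 < (u j).re) (hs : ∀ j, 0 < (s j).re)
    (i : Fin r ⊕ Fin r) : 0 < (Sum.elim s u i).re := by
  cases i
  exacts [hs _, hu _]

/-- The 2r-fold integrand is integrable by the kernel decay, so by Fubini its partial integral in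
`x` is integrable in `t`. -/
theorem integrableOn_etaIntegrand [NeZero r] {δ c : ℝ} (hδ : 0 < δ) (hc : 0 < c)
    (hK : IsDecaying δ c (etaKernel σ a b)) (hb : 1 ≤ b 0) {u s : Fin r → ℂ}
    (hu : ∀ j, 0 < (u j).re) (hs : ∀ j, 0 < (s j).re) :
    IntegrableOn (etaIntegrand σ a b u s) (univ.pi fun _ => Ioi (0 : ℝ)) := by
  have h := integrableOn_comp_sum_elim
    (integrableOn_mellin_integrand hδ hc hK (re_sum_elim_pos hu hs))
  rw [IntegrableOn, Measure.volume_eq_prod, ← Measure.prod_restrict] at h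
  exact IntegrableOn.congr_fun (h.integral_prod_left.const_mul (∏ j, (Complex.Gamma (u j))⁻¹))
    (fun t ht => (etaIntegrand_eq hb hu s fun i => ht i (mem_univ i)).symm) measurableSet_pi_Ioi

theorem mellin_etaKernel_eq_eta [NeZero r] {δ c : ℝ} (hδ : 0 < δ) (hc : 0 < c)
    (hK : IsDecaying δ c (etaKernel σ a b)) (hb : 1 ≤ b 0) (ε : ℝ) {u s : Fin r → ℂ}
    (hu : ∀ j, 0 < (u j).re) (hs : ∀ j, 0 < (s j).re) :
    mellin ε (etaKernel σ a b) (Sum.elim s u) = eta σ a b u s := by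
  have h := integrableOn_comp_sum_elim
    (integrableOn_mellin_integrand hδ hc hK (re_sum_elim_pos hu hs))
  rw [Measure.volume_eq_prod] at h
  rw [mellin_of_re_pos _ _ (re_sum_elim_pos hu hs), setIntegral_sum_pi, Measure.volume_eq_prod,
    setIntegral_prod _ h, eta, setIntegral_congr_fun measurableSet_pi_Ioi
    fun t ht => etaIntegrand_eq hb hu s fun i => ht i (mem_univ i), integral_const_mul,
    Fintype.prod_sum_type]
  simp only [Sum.elim_inl, Sum.elim_inr, one_div]
  ring

theorem analyticOnNhd_mellin_etaKernel {δ c ε : ℝ} (hε : 0 < ε) (hδ : ε < δ) (hc : 0 < c)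
    (hK : IsDecaying δ c (etaKernel σ a b)) :
    AnalyticOnNhd ℂ (fun p : (Fin r → ℂ) × (Fin r → ℂ) =>
      mellin ε (etaKernel σ a b) (Sum.elim p.2 p.1)) univ := by
  -- The kernel has no parameter here; `ℂ` is a dummy parameter space, evaluated at 0 below.
  have h := analyticOnNhd_mellin (E := ℂ) isOpen_univ hε hδ hc (K := fun _ => etaKernel σ a b)
    (fun _ _ => differentiableOn_const _) (fun _ _ => hK)
    fun _ _ => hK.bound.imp fun _ hC => Eventually.of_forall fun _ => hC
  let e : (Fin r → ℂ) × (Fin r → ℂ) →L[ℂ] (Fin r ⊕ Fin r → ℂ) := ContinuousLinearMap.pi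
    (Sum.elim (fun i => (ContinuousLinearMap.proj i).comp (ContinuousLinearMap.snd ℂ _ _))
      fun i => (ContinuousLinearMap.proj i).comp (ContinuousLinearMap.fst ℂ _ _))
  have he : ∀ p, e p = Sum.elim p.2 p.1 := by
    intro p
    funext i
    cases i <;> rfl
  refine (h.comp ((e.prod 0).analyticOnNhd univ) fun _ _ => ⟨mem_univ _, mem_univ _⟩).congr
    isOpen_univ fun p _ => ?_
  simp [he]

theorem hankelFactor_eq_of_ne_int {w : ℂ} (hw : ∀ n : ℤ, w ≠ n) :
    hankelFactor w = (Complex.exp (2 * Real.pi * Complex.I * w) - 1) * Complex.Gamma w ∧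
      hankelFactor w ≠ 0 := by
  have h0 : ∀ n : ℕ, w ≠ -n := fun n => by exact_mod_cast hw (-n)
  have h := hankelFactor_eq h0
  refine ⟨h, ?_⟩
  rw [h]
  refine mul_ne_zero (fun h1 => ?_) (Complex.Gamma_ne_zero h0)
  obtain ⟨n, hn⟩ := Complex.exp_eq_one_iff.mp (sub_eq_zero.mp h1)
  refine hw n (mul_left_cancel₀ Complex.two_pi_I_ne_zero ?_)
  rw [hn, mul_comm]

theorem prod_hankelFactor_mul_mellin_etaKernel {δ c ε ε' : ℝ} (hε : 0 < ε) (hδ : ε < δ)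
    (hε' : 0 < ε') (hδ' : ε' < δ) (hc : 0 < c) (hK : IsDecaying δ c (etaKernel σ a b))
    (u s : Fin r → ℂ) :
    (∏ j, hankelFactor (u j) * hankelFactor (s j)) *
      mellin ε (etaKernel σ a b) (Sum.elim s u) = contourIntegral ε' σ a b u s := by
  rw [contourIntegral_eq_tensor, ← prod_hankelFactor_mul_mellin hε hδ hε' hδ' hc hK,
    Fintype.prod_sum_type, Finset.prod_mul_distrib, mul_comm (∏ j, hankelFactor (u j))]
  simp only [Sum.elim_inl, Sum.elim_inr]

theorem integrable_contourIntegrand {δ c ε : ℝ} (hε : 0 < ε) (hδ : ε < δ) (hc : 0 < c)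
    (hK : IsDecaying δ c (etaKernel σ a b)) (u s : Fin r → ℂ) :
    Integrable (contourIntegrand ε σ a b u s) :=
  (integrable_comp_sum_elim (integrable_tensorIntegrand
    (fun i => admissible_hankelDensity hε hδ hc (Sum.elim s u i)) hK)).congr
    (ae_of_all _ (tensorIntegrand_hankelDensity_etaKernel σ a b ε u s))

end

end ArakawaKaneko

end

/-! ### The main theorem -/

open ArakawaKaneko in
theorem proposition3p3 (r : ℕ) [NeZero r] :
    ∃ ε₀ : ℝ, 0 < ε₀ ∧
      ∀ (σ : Equiv.Perm (Fin r)) (a b : Fin r → ℕ),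
        1 ≤ a 0 → 1 ≤ a (σ.symm 0) → 1 ≤ b 0 → 1 ≤ b (σ.symm 0) →
        (∀ j, 1 ≤ a (σ j) + b j) →
        -- the polylogarithm in the definition of `η` is the analytic continuation of its series
        ArakawaKaneko.IsPolylogContinuation b (fun p => ArakawaKaneko.polylog b p.1 p.2) ∧
        -- the integral defining `η` converges absolutely
        (∀ u s : Fin r → ℂ, (∀ j, 0 < (u j).re) → (∀ j, 0 < (s j).re) →
          MeasureTheory.IntegrableOn (ArakawaKaneko.etaIntegrand σ a b u s)
            (Set.univ.pi (fun _ : Fin r => Set.Ioi (0 : ℝ)))) ∧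
        -- `η` continues analytically to `ℂ^{2r}`, and is given there by the contour integral
        ∃ F : (Fin r → ℂ) × (Fin r → ℂ) → ℂ,
          AnalyticOnNhd ℂ F Set.univ ∧
          (∀ u s : Fin r → ℂ, (∀ j, 0 < (u j).re) → (∀ j, 0 < (s j).re) →
            F (u, s) = ArakawaKaneko.eta σ a b u s) ∧
          ∀ ε : ℝ, 0 < ε → ε < ε₀ → ∀ u s : Fin r → ℂ,
            MeasureTheory.Integrable (ArakawaKaneko.contourIntegrand ε σ a b u s) ∧
            -- where no factor vanishes or has a pole
            ((∀ j, ∀ n : ℤ, u j ≠ n ∧ s j ≠ n) →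
              F (u, s) =
                (∏ j, 1 / ((Complex.exp (2 * Real.pi * Complex.I * u j) - 1) *
                  (Complex.exp (2 * Real.pi * Complex.I * s j) - 1) *
                  Complex.Gamma (u j) * Complex.Gamma (s j))) *
                ArakawaKaneko.contourIntegral ε σ a b u s) ∧
            -- everywhere, with `(e^{2πiw} - 1) Γ(w)` continued to `2πi e^{πiw} / Γ(1 - w)`
            (∏ j, (2 * Real.pi * Complex.I * Complex.exp (Real.pi * Complex.I * u j) *
                (Complex.Gamma (1 - u j))⁻¹) *
              (2 * Real.pi * Complex.I * Complex.exp (Real.pi * Complex.I * s j) *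
                (Complex.Gamma (1 - s j))⁻¹)) * F (u, s) =
              ArakawaKaneko.contourIntegral ε σ a b u s := by
  have hr : (0 : ℝ) < r := Nat.cast_pos.mpr (NeZero.pos r)
  have hδ : (0 : ℝ) < 1 / (10 * r) := by positivity
  have hc : (0 : ℝ) < 1 / 2 := by norm_num
  -- The threshold is the width of the half-strip on which the kernel decays, which depends on `r`
  -- alone. The continuation itself uses the fixed radius of half that width.
  refine ⟨1 / (10 * r), hδ, fun σ a b ha _ hb hb' hab => ?_⟩
  have hK := isDecaying_etaKernel ha hb hb' hab
  refine ⟨isPolylogContinuation_polylog hb,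
    fun u s hu hs => integrableOn_etaIntegrand hδ hc hK hb hu hs,
    fun p => mellin (1 / (10 * r) / 2) (etaKernel σ a b) (Sum.elim p.2 p.1),
    analyticOnNhd_mellin_etaKernel (half_pos hδ) (half_lt_self hδ) hc hK,
    fun u s hu hs => mellin_etaKernel_eq_eta hδ hc hK hb _ hu hs, fun ε hε hε' u s => ?_⟩
  have h := prod_hankelFactor_mul_mellin_etaKernel (half_pos hδ) (half_lt_self hδ) hε hε' hc hK u s
  refine ⟨integrable_contourIntegrand hε hε' hc hK u s, fun hne => ?_, h⟩
  have hu := fun j => hankelFactor_eq_of_ne_int fun n => (hne j n).1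
  have hs := fun j => hankelFactor_eq_of_ne_int fun n => (hne j n).2
  rw [← h, ← mul_assoc, ← Finset.prod_mul_distrib]
  have h1 : ∀ j, 1 / ((Complex.exp (2 * Real.pi * Complex.I * u j) - 1) *
      (Complex.exp (2 * Real.pi * Complex.I * s j) - 1) *
      Complex.Gamma (u j) * Complex.Gamma (s j)) * (hankelFactor (u j) * hankelFactor (s j)) =
      1 := by
    intro j
    rw [one_div_mul_eq_div, div_eq_one_iff_eq]
    · rw [(hu j).1, (hs j).1]
      ring
    · have := mul_ne_zero (hu j).2 (hs j).2
      rw [(hu j).1, (hs j).1] at this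
      convert this using 1
      ring
  simp only [h1, Finset.prod_const_one, one_mul]
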